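/- Let $X$ be a (real or complex) Banach space, let $p\in(1,\infty)$, and let $A:D(A)\subset X\to X$ be a closed, densely defined linear operator; $D(A)$ carries the graph norm $\|x\|_{D(A)}=\|x\|+\|Ax\|$. For $\tau>0$ put $$MR_p(0,\tau)=W^{1,p}([0,\tau],X)\cap L^p([0,\tau],D(A)),\qquad Tr_p=\{u(0):u\in MR_p(0,1)\},$$ where elements of $W^{1,p}([0,\tau],X)$ are identified with their continuous representatives. Given $g\in L^p([0,\tau],X)$ and $x\in X$, a strong solution of $\dot u+Au=g$, $u(0)=x$ on $[0,\tau]$ is a function $u\in MR_p(0,\tau)$ with $u(0)=x$ and $\dot u(t)+Au(t)=g(t)$ for almost every $t\in[0,\tau]$. Assume that $A$ has maximal $L^p$-regularity, that is, for some $\tau_0>0$ and every $g\in L^p([0,\tau_0],X)$ the problem $\dot u+Au=g$, $u(0)=0$ has a unique strong solution on $[0,\tau_0]$. (This implies that $-A$ generates a strongly continuous semigroup on $X$, denoted by $(e^{-tA})_{t\ge 0}$.) Let $P,C:D(A)\to X$ be linear operators, bounded from $D(A)$ with the graph norm to $X$ (but not assumed to be closed or closable in $X$), such that for some $\alpha>0$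 and $\gamma>0$ $$\|Pe^{-\cdot A}x\|_{L^p([0,\alpha],X)}+\|Ce^{-\cdot A}x\|_{L^p([0,\alpha],X)}\le\gamma\|x\|\qquad(x\in D(A)),$$ and let $F:X\to X$ satisfy $\|F(x)-F(y)\|\le\kappa\|x-y\|$ for all $x,y\in X$, with a constant $\kappa>0$. Then for every $\tau>0$ and every $x\in Tr_p$ the problem $$\dot u(t)+Au(t)=Pu(t)+F(Cu(t)),\qquad u(0)=x,\qquad t\in[0,\tau],$$ has a unique strong solution $u\in MR_p(0,\tau)$ (that is, a unique $u\in MR_p(0,\tau)$ with $u(0)=x$ that satisfies the equation for almost every $t\in[0,\tau]$). Moreover, for every $t\in[0,\tau]$, $$u(t)=e^{-tA}x+\int_0^t e^{-(t-s)A}Pu(s)\,ds+\int_0^t e^{-(t-s)A}F(Cu(s))\,ds,$$ where both integrands are integrable on $[0,t]$. -/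

import Mathlib

open MeasureTheory Set Filter Topology
open scoped ENNReal NNReal ContDiff

namespace MaxReg

variable {𝕜 X : Type*} [RCLike 𝕜] [NormedAddCommGroup X] [NormedSpace 𝕜 X] [NormedSpace ℝ X]

/-- Lebesgue measure on the interval `[0, τ]`. -/
noncomputable abbrev timeMeasure (τ : ℝ) : Measure ℝ := volume.restrict (Icc 0 τ)

open Classical in
/-- A linear map `L : D → X` defined on a subspace `D ⊆ X`, evaluated at an arbitrary point of `X`,
with the value `0` outside `D`. Below it is applied to functions whose values lie in `D` at
(almost) all times. -/
noncomputable def app {D : Submodule 𝕜 X} (L : D →ₗ[𝕜] X) (x : X) : X :=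
  if h : x ∈ D then L ⟨x, h⟩ else 0

/-- `L : D(A) → X` is bounded when `D(A)` carries the graph norm `‖x‖ + ‖A x‖`. -/
def IsGraphBounded (A : X →ₗ.[𝕜] X) (L : A.domain →ₗ[𝕜] X) : Prop :=
  ∃ M : ℝ, ∀ x : A.domain, ‖L x‖ ≤ M * (‖(x : X)‖ + ‖A x‖)

/-- `v` is the weak (distributional) derivative of `u` on `(0, τ)`. -/
def HasWeakDeriv (τ : ℝ) (u v : ℝ → X) : Prop :=
  ∀ φ : ℝ → ℝ, ContDiff ℝ ∞ φ → HasCompactSupport φ → tsupport φ ⊆ Ioo 0 τ →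
    ∫ t in Icc 0 τ, deriv φ t • u t = - ∫ t in Icc 0 τ, φ t • v t

/-- `u ∈ W^{1,p}([0, τ], X)`, where `u` is the continuous representative of its class. -/
structure MemW1p (p : ℝ≥0∞) (τ : ℝ) (u : ℝ → X) : Prop where
  continuousOn : ContinuousOn u (Icc 0 τ)
  memLp : MemLp u p (timeMeasure τ)
  exists_weakDeriv : ∃ v : ℝ → X, MemLp v p (timeMeasure τ) ∧ HasWeakDeriv τ u v

/-- `u ∈ L^p([0, τ], D(A))`, where `D(A)` carries the graph norm. -/
structure MemLpDomain (A : X →ₗ.[𝕜] X) (p : ℝ≥0∞) (τ : ℝ) (u : ℝ → X) : Prop where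
  ae_mem : ∀ᵐ t ∂(timeMeasure τ), u t ∈ A.domain
  memLp : MemLp u p (timeMeasure τ)
  memLp_app : MemLp (fun t => app A.toFun (u t)) p (timeMeasure τ)

/-- The space of maximal regularity `MR_p(0, τ) = W^{1,p}([0, τ], X) ∩ L^p([0, τ], D(A))`. -/
def MemMR (A : X →ₗ.[𝕜] X) (p : ℝ≥0∞) (τ : ℝ) (u : ℝ → X) : Prop :=
  MemW1p p τ u ∧ MemLpDomain A p τ u

/-- The trace space `Tr_p = {u(0) : u ∈ MR_p(0, 1)}`. -/
def traceSpace (A : X →ₗ.[𝕜] X) (p : ℝ≥0∞) : Set X :=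
  {x | ∃ u : ℝ → X, MemMR A p 1 u ∧ u 0 = x}

/-- `u` is a strong solution of `u'(t) + A u(t) = g(t)`, `u(0) = x`, on `[0, τ]`:
it belongs to `MR_p(0, τ)` and the equation holds for almost every `t`. -/
structure IsStrongSolution (A : X →ₗ.[𝕜] X) (p : ℝ≥0∞) (τ : ℝ) (g : ℝ → X) (x : X)
    (u : ℝ → X) : Prop where
  memMR : MemMR A p τ u
  initial : u 0 = x
  equation : ∃ v : ℝ → X, MemLp v p (timeMeasure τ) ∧ HasWeakDeriv τ u v ∧
    ∀ᵐ t ∂(timeMeasure τ), v t + app A.toFun (u t) = g t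

/-- Maximal `L^p`-regularity on `[0, τ]`: for every `g ∈ L^p([0, τ], X)` the problem
`u' + A u = g`, `u(0) = 0` has a unique strong solution. -/
def HasMaximalRegularity (A : X →ₗ.[𝕜] X) (p : ℝ≥0∞) (τ : ℝ) : Prop :=
  ∀ g : ℝ → X, MemLp g p (timeMeasure τ) →
    ∃ u : ℝ → X, IsStrongSolution A p τ g 0 u ∧
      ∀ w : ℝ → X, IsStrongSolution A p τ g 0 w → EqOn w u (Icc 0 τ)

/-- `(T(t))_{t ≥ 0}` is a strongly continuous semigroup. Values at `t < 0` are irrelevant. -/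
structure IsC0Semigroup (T : ℝ → X →L[𝕜] X) : Prop where
  zero : T 0 = ContinuousLinearMap.id 𝕜 X
  add : ∀ s t : ℝ, 0 ≤ s → 0 ≤ t → T (s + t) = (T s).comp (T t)
  continuousOn : ∀ x : X, ContinuousOn (fun t => T t x) (Ici 0)

/-- `B` is the infinitesimal generator of `T`: `x ∈ D(B)` and `B x = y` if and only if
`(T(t) x - x) / t → y` as `t ↓ 0`. -/
def IsGenerator (B : X →ₗ.[𝕜] X) (T : ℝ → X →L[𝕜] X) : Prop :=
  ∀ x y : X, (x, y) ∈ B.graph ↔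
    Tendsto (fun t : ℝ => t⁻¹ • (T t x - x)) (𝓝[>] 0) (𝓝 y)

open Classical in
/-- The semigroup `t ↦ e^{-tA}` (`t ≥ 0`) generated by `-A`. A strongly continuous semigroup is
determined on `[0, ∞)` by its generator; if `-A` generates none, the value is `0`. -/
noncomputable def expNeg (A : X →ₗ.[𝕜] X) : ℝ → X →L[𝕜] X :=
  if h : ∃ T : ℝ → X →L[𝕜] X, IsC0Semigroup T ∧ IsGenerator (-A) T then h.choose else 0

/-- The admissibility estimate for some `α > 0` and `γ > 0`:
`‖P e^{-·A} x‖_{L^p([0, α], X)} + ‖C e^{-·A} x‖_{L^p([0, α], X)} ≤ γ ‖x‖` for all `x ∈ D(A)`. -/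
def IsAdmissible (A : X →ₗ.[𝕜] X) (p : ℝ≥0∞) (P C : A.domain →ₗ[𝕜] X) : Prop :=
  ∃ α : ℝ, 0 < α ∧ ∃ γ : ℝ, 0 < γ ∧ ∀ x ∈ A.domain,
    eLpNorm (fun t => app P (expNeg A t x)) p (timeMeasure α) +
      eLpNorm (fun t => app C (expNeg A t x)) p (timeMeasure α) ≤ ENNReal.ofReal (γ * ‖x‖)

end MaxReg

/-!
# Semilinear problems governed by an operator with maximal regularity

The proof replaces weak derivatives by integrals: by the du Bois-Reymond lemma
(`eq_of_hasWeakDeriv_zero`), `u` is a strong solution of `u' + A u = g`, `u(0) = x` if and only if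
`u(t) = x + ∫₀ᵗ (g - y)` for some `y ∈ L^p` with `(u(t), y(t))` in the graph of `A` for almost
every `t`. This is the predicate `Sol`, for which restriction, translation, concatenation and
linear combination are elementary.

*Generation.* The closed graph theorem gives `‖y‖_p ≤ K ‖g‖_p` for zero initial value, with the
same `K` on all intervals `[0, δ]`, `δ ≤ τ₀` (`exists_img_bound`). Let `u` solve `u' + A u = 0`,
`u(0) = x ∈ D(A)`. Then `∫₀ᵗ u` solves the problem with constant right-hand side `x`, so
`‖u‖_{L^p(0, t)} ≤ (1 + K) t^{1/p} ‖x‖`; and `t u(t)` solves the problem with right-hand side `u`,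
so `t ‖u(t)‖ ≤ (1 + K) t^{1 - 1/p} ‖u‖_{L^p(0, t)}`. Together `‖u(t)‖ ≤ (1 + K)² ‖x‖`
(`exists_orbit_bound`), so that the solution operators extend from the dense domain to bounded
operators on `X`. Uniqueness makes them a local semigroup, and its extension to `[0, ∞)` has
generator `-A` (`exists_semigroup`). No resolvent estimates are used, so real and complex scalars
are treated alike.

*Variation of constants.* Integrating `S(t - s) u(s)` in `s` and changing the order of integration
gives the formula integrated once in time (`Sol.integral_eq`); differentiating it under the
integral sign gives the formula itself (`Sol.mild`).

*The perturbation.* Let `L` be `P` or `C`. For a right-hand side `1_E x` with `x ∈ D(A)`, `L u` is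
the convolution of `L S x` with `1_E`, and Young's inequality together with admissibility bounds it
by `Γ ‖x‖ |E|` in `L^p`. Sums of such functions over disjoint sets and density give
`‖L u‖_{L^p(0, δ)} ≤ Γ δ^{1 - 1/p} ‖g‖_{L^p(0, δ)}` for all `g ∈ L^p` and zero initial value
(`Sol.eLpNorm_app_le`); passing to the limit only uses that `L` is bounded in the graph norm and
that `A` has maximal regularity, so `L` need not be closable.

*The fixed point.* As `p > 1`, for small `δ` the map sending `g` to `P u + F(C u)`, with `u` the
solution for `g` and a given initial value, is a contraction of `L^p(0, δ)` whose constant does not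
depend on that initial value (`exists_contractsUpTo`). Its fixed points are the right-hand sides
`P u + F(C u)` of the strong solutions `u` on `[0, δ]`. A solution on `[0, b]` takes values in
`D(A)` at almost all times, so it can be restarted shortly before `b` and continued by a fixed
amount of time (`ContractsUpTo.exists_sol_long`).
-/

/-! ### Primitives and weak derivatives -/

namespace MaxReg

section Primitives

variable {E G : Type*} [NormedAddCommGroup E] [NormedSpace ℝ E]
  [NormedAddCommGroup G] [NormedSpace ℝ G]

/-- Fubini's theorem on the triangle `0 ≤ σ ≤ s ≤ t`. -/
theorem integral_triangle_swap {f : ℝ → ℝ → E} {t : ℝ} (ht : 0 ≤ t)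
    (hf : Integrable (Function.uncurry f)
      ((volume.restrict (Ioc 0 t)).prod (volume.restrict (Ioc 0 t)))) :
    ∫ s in (0 : ℝ)..t, ∫ σ in (0 : ℝ)..s, f s σ = ∫ σ in (0 : ℝ)..t, ∫ s in σ..t, f s σ := by
  have hmeas : MeasurableSet {q : ℝ × ℝ | q.2 ≤ q.1} :=
      measurableSet_le measurable_snd measurable_fst
  have hswap := integral_integral_swap
    (f := fun s σ => {q : ℝ × ℝ | q.2 ≤ q.1}.indicator (Function.uncurry f) (s, σ))
    (hf.indicator hmeas)
  rw [intervalIntegral.integral_of_le ht, intervalIntegral.integral_of_le ht]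
  have h1 : ∫ s in Ioc 0 t, ∫ σ in (0 : ℝ)..s, f s σ = ∫ s in Ioc 0 t, ∫ σ in Ioc 0 t,
      {q : ℝ × ℝ | q.2 ≤ q.1}.indicator (Function.uncurry f) (s, σ) := by
    refine setIntegral_congr_fun measurableSet_Ioc fun s hs => ?_
    rw [intervalIntegral.integral_of_le hs.1.le]
    have : (fun σ => {q : ℝ × ℝ | q.2 ≤ q.1}.indicator (Function.uncurry f) (s, σ)) =
        (Iic s).indicator (f s) := by
      ext σ; simp [indicator]
    rw [this, setIntegral_indicator measurableSet_Iic]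
    congr 2
    ext σ; simp only [mem_Ioc, mem_inter_iff, mem_Iic]
    exact ⟨fun h => ⟨⟨h.1, h.2.trans hs.2⟩, h.2⟩, fun h => ⟨h.1.1, h.2⟩⟩
  have h2 : ∫ σ in Ioc 0 t, ∫ s in σ..t, f s σ = ∫ σ in Ioc 0 t, ∫ s in Ioc 0 t,
      {q : ℝ × ℝ | q.2 ≤ q.1}.indicator (Function.uncurry f) (s, σ) := by
    refine setIntegral_congr_fun measurableSet_Ioc fun σ hσ => ?_
    rw [intervalIntegral.integral_of_le hσ.2]
    have : (fun s => {q : ℝ × ℝ | q.2 ≤ q.1}.indicator (Function.uncurry f) (s, σ)) =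
        (Ici σ).indicator (fun s => f s σ) := by
      ext s; simp [indicator]
    rw [this, setIntegral_indicator measurableSet_Ici, setIntegral_congr_set]
    refine (Ioc_ae_eq_Icc).trans
      (Eq.eventuallyEq (show Icc σ t = Ioc 0 t ∩ Ici σ from ?_))
    ext s; simp only [mem_Icc, mem_inter_iff, mem_Ioc, mem_Ici]
    exact ⟨fun h => ⟨⟨hσ.1.trans_le h.1, h.2⟩, h.1⟩, fun h => ⟨h.2, h.1.2⟩⟩
  rw [h1, h2, hswap]

/-- Integration by parts against the primitive of an integrable function, for a strongly
continuous bounded family of operators. -/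
theorem integral_clm_primitive [CompleteSpace E] [CompleteSpace G] (K : ℝ → E →L[ℝ] G)
    (hK : Continuous fun q : ℝ × E => K q.1 q.2)
    {M : ℝ} (hM : ∀ s, ‖K s‖ ≤ M) {v : ℝ → E} {t : ℝ} (ht : 0 ≤ t)
    (hv : IntegrableOn v (Ioc 0 t)) :
    ∫ s in (0 : ℝ)..t, K s (∫ σ in (0 : ℝ)..s, v σ) =
      ∫ σ in (0 : ℝ)..t, ∫ s in σ..t, K s (v σ) := by
  rw [← integral_triangle_swap (f := fun s σ => K s (v σ)) ht]
  · rw [intervalIntegral.integral_of_le ht, intervalIntegral.integral_of_le ht]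
    refine setIntegral_congr_fun measurableSet_Ioc fun s hs => ?_
    rw [(K s).intervalIntegral_comp_comm]
    rw [intervalIntegrable_iff_integrableOn_Ioc_of_le hs.1.le]
    exact hv.mono_set (Ioc_subset_Ioc_right hs.2)
  · have hvs : AEStronglyMeasurable (fun q : ℝ × ℝ => v q.2)
        ((volume.restrict (Ioc 0 t)).prod (volume.restrict (Ioc 0 t))) :=
      hv.aestronglyMeasurable.comp_snd
    have h2 : Integrable (fun q : ℝ × ℝ => v q.2)
        ((volume.restrict (Ioc 0 t)).prod (volume.restrict (Ioc 0 t))) := Integrable.comp_snd hv _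
    refine Integrable.mono' (h2.norm.const_mul M) ?_ (Eventually.of_forall fun q => ?_)
    · exact hK.comp_aestronglyMeasurable
        ((measurable_fst.aestronglyMeasurable (α := ℝ × ℝ)).prodMk hvs)
    · exact (K q.1).le_of_opNorm_le (hM _) _

/-- A function given by integrating `v` has weak derivative `v`. -/
theorem hasWeakDeriv_of_primitive [CompleteSpace E] {τ : ℝ} (hτ : 0 < τ) {u v : ℝ → E} {x : E}
    (hv : IntegrableOn v (Icc 0 τ)) (hu : ∀ t ∈ Icc 0 τ, u t = x + ∫ s in (0 : ℝ)..t, v s) :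
    HasWeakDeriv τ u v := by
  intro φ hφ hφc hφs
  have h0 : φ 0 = 0 := image_eq_zero_of_notMem_tsupport fun h => by simpa using (hφs h).1
  have h1 : φ τ = 0 := image_eq_zero_of_notMem_tsupport fun h => by simpa using (hφs h).2
  have hd : Continuous (deriv φ) := hφ.continuous_deriv (by simp)
  obtain ⟨M, hM⟩ := hφc.deriv.exists_bound_of_continuous hd
  have hv' : IntegrableOn v (Ioc 0 τ) := hv.mono_set Ioc_subset_Icc_self
  have hint : ∀ a b : ℝ, ∫ s in a..b, deriv φ s = φ b - φ a := fun a b =>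
    intervalIntegral.integral_deriv_eq_sub (fun s _ => (hφ.differentiable (by simp)) s)
      (hd.intervalIntegrable _ _)
  have key := integral_clm_primitive (fun s => deriv φ s • ContinuousLinearMap.id ℝ E)
    (by simp only [_root_.smul_apply, ContinuousLinearMap.id_apply]; fun_prop)
    (M := M) (fun s => by
      refine ContinuousLinearMap.opNorm_le_bound _ ((norm_nonneg _).trans (hM 0)) fun z => ?_
      simp only [_root_.smul_apply, ContinuousLinearMap.id_apply, norm_smul]
      gcongr
      exact hM s) hτ.le hv'
  simp only [_root_.smul_apply, ContinuousLinearMap.id_apply] at key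
  have hcont : ContinuousOn (fun s => ∫ σ in (0 : ℝ)..s, v σ) (Icc 0 τ) := by
    have := intervalIntegral.continuousOn_primitive_interval' (μ := volume) (f := v)
      (a := 0) (b₁ := 0) (b₂ := τ)
      ((intervalIntegrable_iff_integrableOn_Ioc_of_le hτ.le).2 hv') left_mem_uIcc
    rwa [uIcc_of_le hτ.le] at this
  rw [integral_Icc_eq_integral_Ioc, integral_Icc_eq_integral_Ioc,
    ← intervalIntegral.integral_of_le hτ.le, ← intervalIntegral.integral_of_le hτ.le]
  have e1 : ∫ t in (0 : ℝ)..τ, deriv φ t • u t =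
      ∫ t in (0 : ℝ)..τ, (deriv φ t • x + deriv φ t • ∫ s in (0 : ℝ)..t, v s) := by
    refine intervalIntegral.integral_congr fun t ht => ?_
    rw [uIcc_of_le hτ.le] at ht
    simp only [hu t ht, smul_add]
  rw [e1, intervalIntegral.integral_add, key, intervalIntegral.integral_smul_const, hint, h0, h1]
  · simp only [intervalIntegral.integral_smul_const, hint, h1, zero_sub, neg_smul,
      intervalIntegral.integral_neg]
    simp
  · exact (hd.smul continuous_const).intervalIntegrable _ _
  · refine ContinuousOn.intervalIntegrable ?_
    rw [uIcc_of_le hτ.le]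
    exact hd.continuousOn.smul hcont

/-- The du Bois-Reymond lemma: a continuous function with vanishing weak derivative is constant. -/
theorem eq_of_hasWeakDeriv_zero [CompleteSpace E] {τ : ℝ} (hτ : 0 < τ) {w : ℝ → E}
    (hw : ContinuousOn w (Icc 0 τ)) (h : HasWeakDeriv τ w 0) : ∀ t ∈ Icc 0 τ, w t = w 0 := by
  -- a bump function of integral one supported in `(0, τ)`
  obtain ⟨φ, hφ, hφc, hφs, hφi⟩ : ∃ φ : ℝ → ℝ, ContDiff ℝ ∞ φ ∧ HasCompactSupport φ ∧
      tsupport φ ⊆ Ioo 0 τ ∧ ∫ t, φ t = 1 := by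
    let f : ContDiffBump (τ / 2) := ⟨τ / 8, τ / 4, by positivity, by linarith⟩
    refine ⟨f.normed volume, f.contDiff_normed, f.hasCompactSupport_normed, ?_,
      f.integral_normed⟩
    rw [f.tsupport_normed_eq, Real.closedBall_eq_Icc]
    have hr : f.rOut = τ / 4 := rfl
    exact fun t ht => ⟨by linarith [ht.1], by linarith [ht.2]⟩
  set c : E := ∫ t in Icc 0 τ, φ t • w t with hc
  have hwi : ∀ ψ : ℝ → ℝ, Continuous ψ → IntegrableOn (fun t => ψ t • w t) (Icc 0 τ) := fun ψ hψ =>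
    (hψ.continuousOn.smul hw).integrableOn_Icc
  -- a test function of integral zero is the derivative of a test function
  have key : ∀ ψ : ℝ → ℝ, ContDiff ℝ ∞ ψ → HasCompactSupport ψ → tsupport ψ ⊆ Ioo 0 τ →
      ∫ t, ψ t • (w t - c) = 0 := by
    intro ψ hψ hψc hψs
    set I := ∫ t, ψ t with hI
    set θ : ℝ → ℝ := fun t => ψ t - I * φ t with hθ
    have hθd : ContDiff ℝ ∞ θ := hψ.sub (contDiff_const.mul hφ)
    have hθc : HasCompactSupport θ := hψc.sub (hφc.mul_left)
    have hθs : tsupport θ ⊆ Ioo 0 τ :=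
      (tsupport_sub ψ _).trans (union_subset hψs ((tsupport_mul_subset_right).trans hφs))
    have hθi : ∫ t, θ t = 0 := by
      rw [integral_sub (hψ.continuous.integrable_of_hasCompactSupport hψc)
        ((hφ.continuous.integrable_of_hasCompactSupport hφc).const_mul I), integral_const_mul, hφi]
      simp [hI]
    let Θ : ℝ → ℝ := fun t => ∫ s in (0 : ℝ)..t, θ s
    have hΘ' : ∀ t, HasDerivAt Θ (θ t) t := fun t => hθd.continuous.integral_hasStrictDerivAt 0 t
      |>.hasDerivAt
    have hΘderiv : deriv Θ = θ := funext fun t => (hΘ' t).deriv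
    have hΘd : ContDiff ℝ ∞ Θ :=
      contDiff_infty_iff_deriv.2 ⟨fun t => (hΘ' t).differentiableAt, hΘderiv ▸ hθd⟩
    -- `Θ` vanishes off the interval `[a, b]` spanned by the support of `θ`
    obtain ⟨a, b, ha0, hab, hbτ, hsab⟩ : ∃ a b : ℝ, 0 < a ∧ a ≤ b ∧ b < τ ∧
        tsupport θ ⊆ Icc a b := by
      rcases (tsupport θ).eq_empty_or_nonempty with he | hne
      · exact ⟨τ / 2, τ / 2, by linarith, le_rfl, by linarith, by simp [he]⟩
      · obtain ⟨a, ha⟩ := (hθc : IsCompact (tsupport θ)).exists_isLeast hne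
        obtain ⟨b, hb⟩ := (hθc : IsCompact (tsupport θ)).exists_isGreatest hne
        exact ⟨a, b, (hθs ha.1).1, ha.2 hb.1, (hθs hb.1).2, fun t ht => ⟨ha.2 ht, hb.2 ht⟩⟩
    have hz : ∀ t, t ∉ Icc a b → θ t = 0 := fun t ht =>
      image_eq_zero_of_notMem_tsupport fun h => ht (hsab h)
    have hΘs : Function.support Θ ⊆ Icc a b := by
      intro t ht
      by_contra hn
      refine ht ?_
      rcases lt_or_ge t a with hta | hta
      · refine intervalIntegral.integral_zero_ae (Eventually.of_forall fun s hs => hz s fun h => ?_)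
        have := hs.2
        have : s ≤ max 0 t := hs.2
        rcases le_max_iff.1 this with h' | h' <;> linarith [h.1]
      · have htb : b < t := by
          by_contra h'; exact hn ⟨hta, not_lt.1 h'⟩
        have : ∫ s in (0 : ℝ)..t, θ s = ∫ s, θ s := by
          rw [intervalIntegral.integral_of_le (by linarith)]
          refine setIntegral_eq_integral_of_forall_compl_eq_zero fun s hs => hz s fun h => hs ?_
          exact ⟨by linarith [h.1], by linarith [h.2]⟩
        change (∫ s in (0 : ℝ)..t, θ s) = 0
        rw [this, hθi]
    have hΘts : tsupport Θ ⊆ Icc a b := closure_minimal hΘs isClosed_Icc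
    have h0 := h Θ hΘd (HasCompactSupport.of_support_subset_isCompact isCompact_Icc hΘs)
      (hΘts.trans fun t ht => ⟨by linarith [ht.1], by linarith [ht.2]⟩)
    simp only [hΘderiv, Pi.zero_apply, smul_zero, integral_zero, neg_zero, hθ, sub_smul,
      mul_smul] at h0
    have iφ : Integrable (fun t => I • φ t • w t) (volume.restrict (Icc 0 τ)) :=
      (hwi φ hφ.continuous).smul I
    rw [integral_sub (hwi ψ hψ.continuous) iφ, integral_smul, ← hc] at h0
    have e : ∫ t, ψ t • (w t - c) = ∫ t in Icc 0 τ, ψ t • (w t - c) := by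
      refine (setIntegral_eq_integral_of_forall_compl_eq_zero fun s hs => ?_).symm
      rw [image_eq_zero_of_notMem_tsupport fun h => hs (Ioo_subset_Icc_self (hψs h)), zero_smul]
    have eI : ∫ t in Icc 0 τ, ψ t = I := by
      refine (setIntegral_eq_integral_of_forall_compl_eq_zero fun s hs => ?_)
      rw [image_eq_zero_of_notMem_tsupport fun h => hs (Ioo_subset_Icc_self (hψs h))]
    simp only [smul_sub] at e ⊢
    have ic : IntegrableOn (fun t => ψ t • c) (Icc 0 τ) :=
      (hψ.continuous.smul continuous_const).continuousOn.integrableOn_Icc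
    rw [e, integral_sub (hwi ψ hψ.continuous) ic, integral_smul_const, eI, h0]
  have hae := isOpen_Ioo.ae_eq_zero_of_integral_contDiff_smul_eq_zero (μ := volume)
    (f := fun t => w t - c) (U := Ioo 0 τ)
    (((hw.sub continuousOn_const).mono Ioo_subset_Icc_self).locallyIntegrableOn
      measurableSet_Ioo) key
  have hIcc : ∀ t ∈ Icc 0 τ, w t = c := by
    have h1 : (fun t => w t) =ᵐ[volume.restrict (Icc 0 τ)] fun _ => c := by
      rw [← restrict_Ioo_eq_restrict_Icc, EventuallyEq, ae_restrict_iff' measurableSet_Ioo]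
      filter_upwards [hae] with t ht h
      exact sub_eq_zero.1 (ht h)
    exact fun t ht => Measure.eqOn_Icc_of_ae_eq volume hτ.ne h1 hw continuousOn_const ht
  exact fun t ht => (hIcc t ht).trans (hIcc 0 ⟨le_rfl, hτ.le⟩).symm

/-- A continuous function with integrable weak derivative is the primitive of that derivative. -/
theorem eq_primitive_of_hasWeakDeriv [CompleteSpace E] {τ : ℝ} (hτ : 0 < τ) {u v : ℝ → E}
    (hu : ContinuousOn u (Icc 0 τ)) (hv : IntegrableOn v (Icc 0 τ)) (h : HasWeakDeriv τ u v) :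
    ∀ t ∈ Icc 0 τ, u t = u 0 + ∫ s in (0 : ℝ)..t, v s := by
  have hcont : ContinuousOn (fun s => ∫ σ in (0 : ℝ)..s, v σ) (Icc 0 τ) := by
    have := intervalIntegral.continuousOn_primitive_interval' (μ := volume) (f := v)
      (a := 0) (b₁ := 0) (b₂ := τ)
      ((intervalIntegrable_iff_integrableOn_Ioc_of_le hτ.le).2 (hv.mono_set Ioc_subset_Icc_self))
      left_mem_uIcc
    rwa [uIcc_of_le hτ.le] at this
  have h2 : HasWeakDeriv τ (fun t => ∫ s in (0 : ℝ)..t, v s) v :=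
    hasWeakDeriv_of_primitive (x := 0) hτ hv fun t _ => by simp
  have h3 : HasWeakDeriv τ (fun t => u t - ∫ s in (0 : ℝ)..t, v s) 0 := by
    intro φ hφ hφc hφs
    have hd : Continuous (deriv φ) := hφ.continuous_deriv (by simp)
    simp only [smul_sub, Pi.zero_apply, smul_zero, integral_zero, neg_zero]
    have i1 : IntegrableOn (fun t => deriv φ t • u t) (Icc 0 τ) :=
      (hd.continuousOn.smul hu).integrableOn_Icc
    have i2 : IntegrableOn (fun t => deriv φ t • ∫ s in (0 : ℝ)..t, v s) (Icc 0 τ) :=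
      (hd.continuousOn.smul hcont).integrableOn_Icc
    rw [integral_sub i1 i2, h φ hφ hφc hφs, h2 φ hφ hφc hφs, sub_self]
  intro t ht
  have h4 : u t - ∫ s in (0 : ℝ)..t, v s = u 0 - ∫ s in (0 : ℝ)..(0 : ℝ), v s :=
    eq_of_hasWeakDeriv_zero hτ (hu.sub hcont) h3 t ht
  rw [intervalIntegral.integral_same, sub_zero] at h4
  rw [← h4]; abel

end Primitives
/-! ### Strong solutions in integrated form -/

section Graph

variable {𝕜 X : Type*} [RCLike 𝕜] [NormedAddCommGroup X] [NormedSpace 𝕜 X]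
  {A : X →ₗ.[𝕜] X}

theorem app_of_mem {D : Submodule 𝕜 X} (L : D →ₗ[𝕜] X) {x : X} (hx : x ∈ D) :
    app L x = L ⟨x, hx⟩ := dif_pos hx

theorem app_add {D : Submodule 𝕜 X} (L : D →ₗ[𝕜] X) {x y : X} (hx : x ∈ D) (hy : y ∈ D) :
    app L (x + y) = app L x + app L y := by
  rw [app_of_mem L hx, app_of_mem L hy, app_of_mem L (D.add_mem hx hy), ← map_add]
  rfl

theorem app_sub {D : Submodule 𝕜 X} (L : D →ₗ[𝕜] X) {x y : X} (hx : x ∈ D) (hy : y ∈ D) :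
    app L (x - y) = app L x - app L y := by
  rw [app_of_mem L hx, app_of_mem L hy, app_of_mem L (D.sub_mem hx hy), ← map_sub]
  rfl

theorem app_eq_of_mem_graph {x y : X} (h : (x, y) ∈ A.graph) : app A.toFun x = y := by
  have hx := LinearPMap.mem_domain_of_mem_graph h
  rw [app_of_mem _ hx]
  exact ((LinearPMap.image_iff hx).2 h).symm

theorem mem_graph_app {x : X} (hx : x ∈ A.domain) : (x, app A.toFun x) ∈ A.graph := by
  rw [app_of_mem _ hx]
  exact A.mem_graph ⟨x, hx⟩

variable [NormedSpace ℝ X] [IsScalarTower ℝ 𝕜 X]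

theorem real_smul_mem_graph (c : ℝ) {x y : X} (h : (x, y) ∈ A.graph) :
    (c • x, c • y) ∈ A.graph :=
  (A.graph.restrictScalars ℝ).smul_mem c h

/-- The graph of a closed operator is stable under integration. -/
theorem integral_mem_graph [CompleteSpace X] (hA : A.IsClosed) {α : Type*} [MeasurableSpace α]
    {μ : Measure α} {f g : α → X} (hf : Integrable f μ) (hg : Integrable g μ)
    (h : ∀ᵐ t ∂μ, (f t, g t) ∈ A.graph) : (∫ t, f t ∂μ, ∫ t, g t ∂μ) ∈ A.graph := by
  let S := A.graph.restrictScalars ℝ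
  have hS : IsClosed (S : Set (X × X)) := hA
  have h1 : S.mkQL (∫ t, (f t, g t) ∂μ) = 0 := by
    rw [← S.mkQL.integral_comp_comm (hf.prodMk hg)]
    refine integral_eq_zero_of_ae ?_
    filter_upwards [h] with t ht
    exact (Submodule.Quotient.mk_eq_zero S).2 ht
  rw [integral_pair hf hg] at h1
  exact (Submodule.Quotient.mk_eq_zero S).1 h1

theorem intervalIntegral_mem_graph [CompleteSpace X] (hA : A.IsClosed) {a b : ℝ} (hab : a ≤ b)
    {f g : ℝ → X} (hf : IntervalIntegrable f volume a b) (hg : IntervalIntegrable g volume a b)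
    (h : ∀ᵐ t ∂volume.restrict (Ioc a b), (f t, g t) ∈ A.graph) :
    (∫ t in a..b, f t, ∫ t in a..b, g t) ∈ A.graph := by
  rw [intervalIntegral.integral_of_le hab, intervalIntegral.integral_of_le hab]
  exact integral_mem_graph hA hf.1 hg.1 h

end Graph

section Time

variable {X : Type*}

/-- Follow `f` up to time `a` and then `f'`, started at time `a`. -/
noncomputable def glue (a : ℝ) (f f' : ℝ → X) (t : ℝ) : X := if t ≤ a then f t else f' (t - a)

theorem glue_of_le {a t : ℝ} (h : t ≤ a) (f f' : ℝ → X) : glue a f f' t = f t := if_pos h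

theorem glue_of_lt {a t : ℝ} (h : a < t) (f f' : ℝ → X) : glue a f f' t = f' (t - a) :=
  if_neg (not_le.2 h)

variable [NormedAddCommGroup X] {p : ℝ≥0∞} {τ : ℝ}

theorem timeMeasure_mono {a b : ℝ} (hab : a ≤ b) : timeMeasure a ≤ timeMeasure b :=
  Measure.restrict_mono (Icc_subset_Icc_right hab) le_rfl

theorem integrableOn_of_memLp (hp : 1 ≤ p) {f : ℝ → X} (hf : MemLp f p (timeMeasure τ)) :
    IntegrableOn f (Icc 0 τ) := hf.integrable hp

theorem intervalIntegrable_of_integrableOn {f : ℝ → X} (hf : IntegrableOn f (Icc 0 τ)) {a b : ℝ}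
    (ha : 0 ≤ a) (hab : a ≤ b) (hb : b ≤ τ) : IntervalIntegrable f volume a b := by
  rw [intervalIntegrable_iff_integrableOn_Ioc_of_le hab]
  exact hf.mono_set (Ioc_subset_Icc_self.trans (Icc_subset_Icc ha hb))

theorem memLp_of_continuousOn {f : ℝ → X} (hf : ContinuousOn f (Icc 0 τ)) :
    MemLp f p (timeMeasure τ) := by
  obtain ⟨M, hM⟩ := isCompact_Icc.exists_bound_of_continuousOn hf
  refine MemLp.of_bound (hf.aestronglyMeasurable measurableSet_Icc) M ?_
  rw [ae_restrict_iff' measurableSet_Icc]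
  exact Eventually.of_forall hM

theorem memLp_shift {f : ℝ → X} {a b : ℝ} (ha : 0 ≤ a) (hf : MemLp f p (timeMeasure (a + b))) :
    MemLp (fun t => f (a + t)) p (timeMeasure b) := by
  have h := (measurePreserving_add_left (volume : Measure ℝ) a).restrict_preimage
    (s := Icc a (a + b)) measurableSet_Icc
  have e : (fun t => a + t) ⁻¹' Icc a (a + b) = Icc 0 b := by
    ext t; simp
  rw [e] at h
  exact (hf.mono_measure (Measure.restrict_mono (Icc_subset_Icc_left ha)
      le_rfl)).comp_measurePreserving h

theorem memLp_shift_right {f : ℝ → X} {a b : ℝ} (hf : MemLp f p (timeMeasure b)) :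
    MemLp (fun t => f (t - a)) p (volume.restrict (Icc a (a + b))) := by
  have h := (measurePreserving_sub_right (volume : Measure ℝ) a).restrict_preimage
    (s := Icc 0 b) measurableSet_Icc
  have e : (fun t => t - a) ⁻¹' Icc 0 b = Icc a (a + b) := by
    ext t; simp [add_comm]
  rw [e] at h
  exact hf.comp_measurePreserving h

theorem memLp_glue {f f' : ℝ → X} {a b : ℝ} (hf : MemLp f p (timeMeasure a))
    (hf' : MemLp f' p (timeMeasure b)) : MemLp (glue a f f') p (timeMeasure (a + b)) := by
  have e : glue a f f' = (Iic a).indicator f + (Ioi a).indicator (fun t => f' (t - a)) := by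
    ext t
    by_cases h : t ≤ a
    · simp [glue_of_le h, h]
    · simp [glue_of_lt (not_le.1 h), not_le.1 h]
  rw [e]
  refine MemLp.add ?_ ?_
  · rw [memLp_indicator_iff_restrict measurableSet_Iic, timeMeasure,
      Measure.restrict_restrict measurableSet_Iic]
    refine hf.mono_measure (Measure.restrict_mono ?_ le_rfl)
    exact fun t ht => ⟨ht.2.1, ht.1⟩
  · rw [memLp_indicator_iff_restrict measurableSet_Ioi, timeMeasure,
      Measure.restrict_restrict measurableSet_Ioi]
    refine (memLp_shift_right (a := a) hf').mono_measure (Measure.restrict_mono ?_ le_rfl)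
    exact fun t ht => ⟨le_of_lt ht.1, ht.2.2⟩

end Time

section Sol

variable {𝕜 X : Type*} [RCLike 𝕜] [NormedAddCommGroup X] [NormedSpace 𝕜 X]
  [NormedSpace ℝ X]

/-- `u` solves `u' + A u = g`, `u(0) = x` on `[0, τ]` in integrated form, with `y` a representative
of the class of `A u` in `L^p`. -/
structure Sol (A : X →ₗ.[𝕜] X) (p : ℝ≥0∞) (τ : ℝ) (g : ℝ → X) (x : X) (u y : ℝ → X) : Prop where
  memLp_rhs : MemLp g p (timeMeasure τ)
  memLp_img : MemLp y p (timeMeasure τ)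
  eq : ∀ t ∈ Icc 0 τ, u t = x + ∫ s in (0 : ℝ)..t, (g s - y s)
  graph : ∀ᵐ t ∂(timeMeasure τ), (u t, y t) ∈ A.graph

variable {A : X →ₗ.[𝕜] X} {p : ℝ≥0∞} {τ : ℝ}

namespace Sol

variable {g g' u u' y y' : ℝ → X} {x x' : X}

theorem initial (h : Sol A p τ g x u y) (hτ : 0 ≤ τ) : u 0 = x := by
  simpa using h.eq 0 ⟨le_rfl, hτ⟩

theorem eq_sub_integral (h : Sol A p τ (fun _ => 0) x u y) {t : ℝ} (ht : t ∈ Icc 0 τ) :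
    u t = x - ∫ s in (0 : ℝ)..t, y s := by
  rw [h.eq t ht]
  simp only [zero_sub, intervalIntegral.integral_neg]
  abel

theorem integrableOn (hp : 1 ≤ p) (h : Sol A p τ g x u y) :
    IntegrableOn (fun s => g s - y s) (Icc 0 τ) :=
  (integrableOn_of_memLp hp h.memLp_rhs).sub (integrableOn_of_memLp hp h.memLp_img)

theorem continuousOn (hp : 1 ≤ p) (hτ : 0 ≤ τ) (h : Sol A p τ g x u y) :
    ContinuousOn u (Icc 0 τ) := by
  have := intervalIntegral.continuousOn_primitive_interval' (μ := volume)
    (f := fun s => g s - y s) (a := 0) (b₁ := 0) (b₂ := τ)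
    (intervalIntegrable_of_integrableOn (h.integrableOn hp) le_rfl hτ le_rfl) left_mem_uIcc
  rw [uIcc_of_le hτ] at this
  exact (continuousOn_const.add this).congr h.eq

theorem add (hp : 1 ≤ p) (h : Sol A p τ g x u y) (h' : Sol A p τ g' x' u' y') :
    Sol A p τ (fun t => g t + g' t) (x + x') (fun t => u t + u' t) (fun t => y t + y' t) where
  memLp_rhs := h.memLp_rhs.add h'.memLp_rhs
  memLp_img := h.memLp_img.add h'.memLp_img
  eq t ht := by
    rw [h.eq t ht, h'.eq t ht, add_add_add_comm, ← intervalIntegral.integral_add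
      (intervalIntegrable_of_integrableOn (h.integrableOn hp) le_rfl ht.1 ht.2)
      (intervalIntegrable_of_integrableOn (h'.integrableOn hp) le_rfl ht.1 ht.2)]
    congr 2; ext s; abel
  graph := by
    filter_upwards [h.graph, h'.graph] with t ht ht'
    exact A.graph.add_mem ht ht'

theorem smul [IsScalarTower ℝ 𝕜 X] (c : 𝕜) (h : Sol A p τ g x u y) :
    Sol A p τ (fun t => c • g t) (c • x) (fun t => c • u t) (fun t => c • y t) where
  memLp_rhs := h.memLp_rhs.const_smul c
  memLp_img := h.memLp_img.const_smul c
  eq t ht := by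
    have : SMulCommClass ℝ 𝕜 X := IsScalarTower.to_smulCommClass
    have : SMulCommClass 𝕜 ℝ X := SMulCommClass.symm _ _ _
    rw [h.eq t ht, smul_add, ← intervalIntegral.integral_smul]
    simp only [smul_sub]
  graph := by
    filter_upwards [h.graph] with t ht
    exact A.graph.smul_mem c ht

theorem sub [IsScalarTower ℝ 𝕜 X] (hp : 1 ≤ p) (h : Sol A p τ g x u y)
    (h' : Sol A p τ g' x' u' y') :
    Sol A p τ (fun t => g t - g' t) (x - x') (fun t => u t - u' t) (fun t => y t - y' t) := by
  simpa [sub_eq_add_neg] using h.add hp (h'.smul (-1 : 𝕜))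

theorem mono {b : ℝ} (h : Sol A p τ g x u y) (hb : b ≤ τ) : Sol A p b g x u y where
  memLp_rhs := h.memLp_rhs.mono_measure (timeMeasure_mono hb)
  memLp_img := h.memLp_img.mono_measure (timeMeasure_mono hb)
  eq t ht := h.eq t ⟨ht.1, ht.2.trans hb⟩
  graph := ae_mono (timeMeasure_mono hb) h.graph

theorem congr_rhs (h : Sol A p τ g x u y) (hg : g =ᵐ[timeMeasure τ] g') :
    Sol A p τ g' x u y where
  memLp_rhs := h.memLp_rhs.ae_eq hg
  memLp_img := h.memLp_img
  eq t ht := by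
    rw [h.eq t ht]
    congr 1
    refine intervalIntegral.integral_congr_ae ?_
    rw [uIoc_of_le ht.1]
    filter_upwards [(ae_restrict_iff' measurableSet_Icc).1 hg] with s hs hs'
    rw [hs ⟨hs'.1.le, hs'.2.trans ht.2⟩]
  graph := h.graph

/-- A constant function with value in the domain. -/
theorem const [CompleteSpace X] {z : X} (h : (x, z) ∈ A.graph) :
    Sol A p τ (fun _ => z) x (fun _ => x) (fun _ => z) where
  memLp_rhs := memLp_of_continuousOn continuousOn_const
  memLp_img := memLp_of_continuousOn continuousOn_const
  eq t _ := by simp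
  graph := Eventually.of_forall fun _ => h

theorem shift (hp : 1 ≤ p) {a b : ℝ} (ha : 0 ≤ a) (h : Sol A p (a + b) g x u y) :
    Sol A p b (fun t => g (a + t)) (u a) (fun t => u (a + t)) (fun t => y (a + t)) where
  memLp_rhs := memLp_shift ha h.memLp_rhs
  memLp_img := memLp_shift ha h.memLp_img
  eq t ht := by
    have hb : 0 ≤ b := ht.1.trans ht.2
    have i := h.integrableOn hp
    have e := intervalIntegral.integral_comp_add_left (a := 0) (b := t) (fun s => g s - y s) a
    rw [h.eq a ⟨ha, by linarith⟩, h.eq (a + t) ⟨by linarith [ht.1], by linarith [ht.2]⟩, e,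
      add_zero, add_assoc, intervalIntegral.integral_add_adjacent_intervals
      (intervalIntegrable_of_integrableOn i le_rfl ha (by linarith))
      (intervalIntegrable_of_integrableOn i ha (by linarith [ht.1]) (by linarith [ht.2]))]
  graph := by
    have h1 := (measurePreserving_add_left (volume : Measure ℝ) a).quasiMeasurePreserving.ae
      ((ae_restrict_iff' measurableSet_Icc).1 h.graph)
    rw [ae_restrict_iff' measurableSet_Icc]
    filter_upwards [h1] with t ht ht'
    exact ht ⟨by linarith [ht'.1], by linarith [ht'.2]⟩

theorem glue (hp : 1 ≤ p) {a b : ℝ} (ha : 0 ≤ a) (h : Sol A p a g x u y)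
    (h' : Sol A p b g' (u a) u' y') :
    Sol A p (a + b) (glue a g g') x (glue a u u') (glue a y y') where
  memLp_rhs := memLp_glue h.memLp_rhs h'.memLp_rhs
  memLp_img := memLp_glue h.memLp_img h'.memLp_img
  eq t ht := by
    have hcongr : ∀ t, 0 ≤ t → t ≤ a →
        ∫ s in (0 : ℝ)..t, (MaxReg.glue a g g' s - MaxReg.glue a y y' s) =
        ∫ s in (0 : ℝ)..t, (g s - y s) := fun t h0 h1 => by
      refine intervalIntegral.integral_congr fun s hs => ?_
      rw [uIcc_of_le h0] at hs
      simp only [glue_of_le (hs.2.trans h1)]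
    rcases le_or_gt t a with hta | hta
    · rw [glue_of_le hta, h.eq t ⟨ht.1, hta⟩, hcongr t ht.1 hta]
    · have hcongr' : EqOn (fun s => g' (s - a) - y' (s - a))
          (fun s => MaxReg.glue a g g' s - MaxReg.glue a y y' s) (Ioc a t) := fun s hs => by
        simp only [glue_of_lt hs.1]
      have i1 : IntervalIntegrable (fun s => MaxReg.glue a g g' s - MaxReg.glue a y y' s)
          volume 0 (a + b) :=
        intervalIntegrable_of_integrableOn
          ((integrableOn_of_memLp hp (memLp_glue h.memLp_rhs h'.memLp_rhs)).sub
          (integrableOn_of_memLp hp (memLp_glue h.memLp_img h'.memLp_img))) le_rfl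
          (ht.1.trans ht.2) le_rfl
      rw [← intervalIntegral.integral_add_adjacent_intervals (b := a)
        (i1.mono_set (by rw [uIcc_of_le ha, uIcc_of_le (ht.1.trans ht.2)]
                         exact Icc_subset_Icc_right (hta.le.trans ht.2)))
        (i1.mono_set (by rw [uIcc_of_le hta.le, uIcc_of_le (ht.1.trans ht.2)]
                         exact Icc_subset_Icc ha ht.2)), hcongr a ha le_rfl,
        glue_of_lt hta, h'.eq (t - a) ⟨by linarith, by linarith [ht.2]⟩, h.eq a ⟨ha, le_rfl⟩,
        add_assoc]
      congr 2
      have e := intervalIntegral.integral_comp_sub_right (a := a) (b := t) (fun s => g' s - y' s) a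
      rw [sub_self] at e
      rw [← e]
      rw [intervalIntegral.integral_of_le hta.le, intervalIntegral.integral_of_le hta.le]
      exact setIntegral_congr_fun measurableSet_Ioc hcongr'
  graph := by
    have h1 := (measurePreserving_sub_right (volume : Measure ℝ) a).quasiMeasurePreserving.ae
      ((ae_restrict_iff' measurableSet_Icc).1 h'.graph)
    rw [ae_restrict_iff' measurableSet_Icc]
    filter_upwards [h1, (ae_restrict_iff' measurableSet_Icc).1 h.graph] with t ht ht' hm
    rcases le_or_gt t a with hta | hta
    · rw [glue_of_le hta, glue_of_le hta]
      exact ht' ⟨hm.1, hta⟩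
    · rw [glue_of_lt hta, glue_of_lt hta]
      exact ht ⟨by linarith, by linarith [hm.2]⟩

/-- For a null right-hand side and a null initial value the zero function is a solution. -/
theorem zero : Sol A p τ (fun _ => 0) 0 (fun _ => 0) (fun _ => 0) where
  memLp_rhs := MemLp.zero'
  memLp_img := MemLp.zero'
  eq t _ := by simp
  graph := Eventually.of_forall fun _ => A.graph.zero_mem

theorem img_ae_eq (h : Sol A p τ g x u y) (h' : Sol A p τ g' x' u' y')
    (hu : EqOn u u' (Icc 0 τ)) : y =ᵐ[timeMeasure τ] y' := by
  filter_upwards [h.graph, h'.graph, ae_restrict_mem measurableSet_Icc] with t ht ht' hm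
  exact A.mem_graph_snd_inj ht ht' (hu hm)

end Sol

theorem isStrongSolution_iff [CompleteSpace X] (hp : 1 ≤ p) (hτ : 0 < τ) {g u : ℝ → X} {x : X} :
    IsStrongSolution A p τ g x u ↔ ∃ y, Sol A p τ g x u y := by
  constructor
  · rintro ⟨hmr, h0, v, hv, hvw, he⟩
    have hy := hmr.2.memLp_app
    have hg : (fun t => v t + app A.toFun (u t)) =ᵐ[timeMeasure τ] g := he
    refine ⟨fun t => app A.toFun (u t), (hv.add hy).ae_eq hg, hy, fun t ht => ?_, ?_⟩
    · rw [eq_primitive_of_hasWeakDeriv hτ hmr.1.continuousOn (integrableOn_of_memLp hp hv) hvw t ht,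
        h0]
      congr 1
      refine intervalIntegral.integral_congr_ae ?_
      rw [uIoc_of_le ht.1]
      filter_upwards [(ae_restrict_iff' measurableSet_Icc).1 he] with s hs hs'
      rw [← hs ⟨hs'.1.le, hs'.2.trans ht.2⟩, add_sub_cancel_right]
    · filter_upwards [hmr.2.ae_mem] with t ht
      exact mem_graph_app ht
  · rintro ⟨y, h⟩
    have hc := h.continuousOn hp hτ.le
    have hw := hasWeakDeriv_of_primitive hτ (h.integrableOn hp) h.eq
    have hy : y =ᵐ[timeMeasure τ] fun t => app A.toFun (u t) := by
      filter_upwards [h.graph] with t ht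
      exact (app_eq_of_mem_graph ht).symm
    have hv := h.memLp_rhs.sub h.memLp_img
    refine ⟨⟨⟨hc, memLp_of_continuousOn hc, _, hv, hw⟩, ?_, memLp_of_continuousOn hc,
      h.memLp_img.ae_eq hy⟩, h.initial hτ.le, _, hv, hw, ?_⟩
    · filter_upwards [h.graph] with t ht
      exact LinearPMap.mem_domain_of_mem_graph ht
    · filter_upwards [hy] with t ht
      rw [← ht, Pi.sub_apply, sub_add_cancel]

/-- Points of the trace space are initial values of solutions for some right-hand side. -/
theorem exists_sol_of_mem_traceSpace [CompleteSpace X] (hp : 1 ≤ p) {x : X}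
    (hx : x ∈ traceSpace A p) : ∃ g u y, Sol A p 1 g x u y := by
  obtain ⟨u, hu, h0⟩ := hx
  obtain ⟨v, hv, hvw⟩ := hu.1.exists_weakDeriv
  obtain ⟨y, hy⟩ := (isStrongSolution_iff hp one_pos).1
    (⟨hu, h0, v, hv, hvw, Eventually.of_forall fun _ => rfl⟩ :
      IsStrongSolution A p 1 (fun t => v t + app A.toFun (u t)) x u)
  exact ⟨_, u, y, hy⟩

end Sol
/-! ### Maximal regularity estimates -/

section Time

variable {p : ℝ≥0∞}

theorem one_sub_one_div_toReal_nonneg (hp : 1 ≤ p) : 0 ≤ 1 - 1 / p.toReal := by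
  rw [sub_nonneg]
  rcases eq_or_ne p ⊤ with rfl | htop
  · simp
  rw [div_le_one (ENNReal.toReal_pos (zero_lt_one.trans_le hp).ne' htop)]
  simpa using ENNReal.toReal_mono htop hp

variable {X : Type*} [NormedAddCommGroup X]

theorem eLpNorm_one_le (hp : 1 ≤ p) {t : ℝ} {f : ℝ → X}
    (hf : AEStronglyMeasurable f (timeMeasure t)) :
    eLpNorm f 1 (timeMeasure t) ≤
      eLpNorm f p (timeMeasure t) * ENNReal.ofReal t ^ (1 - 1 / p.toReal) := by
  simpa using eLpNorm_le_eLpNorm_mul_rpow_measure_univ hp hf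

theorem enorm_integral_le [NormedSpace ℝ X] (hp : 1 ≤ p) {t : ℝ} (ht : 0 ≤ t) {f : ℝ → X}
    (hf : AEStronglyMeasurable f (timeMeasure t)) :
    ‖∫ s in (0 : ℝ)..t, f s‖ₑ ≤
      eLpNorm f p (timeMeasure t) * ENNReal.ofReal t ^ (1 - 1 / p.toReal) := by
  refine le_trans ?_ (eLpNorm_one_le hp hf)
  rw [intervalIntegral.integral_of_le ht, ← integral_Icc_eq_integral_Ioc,
    eLpNorm_one_eq_lintegral_enorm]
  exact enorm_integral_le_lintegral_enorm _

end Time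

section Regularity


variable {𝕜 X : Type*} [RCLike 𝕜] [NormedAddCommGroup X] [NormedSpace 𝕜 X]
  [NormedSpace ℝ X] [CompleteSpace X] {A : X →ₗ.[𝕜] X} {p : ℝ≥0∞} {τ₀ : ℝ}

theorem exists_sol_zero (hp : 1 ≤ p) (hτ₀ : 0 < τ₀) (hreg : HasMaximalRegularity A p τ₀)
    {δ : ℝ} (hδ : δ ≤ τ₀) {g : ℝ → X} (hg : MemLp g p (timeMeasure δ)) :
    ∃ u y, Sol A p δ g 0 u y := by
  have e : (timeMeasure τ₀).restrict (Icc 0 δ) = timeMeasure δ := by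
    rw [timeMeasure, Measure.restrict_restrict measurableSet_Icc,
      inter_eq_left.2 (Icc_subset_Icc_right hδ)]
  have hg' : MemLp ((Icc 0 δ).indicator g) p (timeMeasure τ₀) := by
    rwa [memLp_indicator_iff_restrict measurableSet_Icc, e]
  obtain ⟨u, hu, -⟩ := hreg _ hg'
  obtain ⟨y, hy⟩ := (isStrongSolution_iff hp hτ₀).1 hu
  refine ⟨u, y, (hy.mono hδ).congr_rhs ?_⟩
  filter_upwards [ae_restrict_mem measurableSet_Icc] with t ht
  rw [indicator_of_mem ht]

/-- Every point of the domain is the initial value of an orbit on `[0, τ₀]`. -/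
theorem exists_orbit (hp : 1 ≤ p) (hτ₀ : 0 < τ₀) (hreg : HasMaximalRegularity A p τ₀) {x : X}
    (hx : x ∈ A.domain) : ∃ u y, Sol A p τ₀ (fun _ => 0) x u y := by
  obtain ⟨u, y, h⟩ := exists_sol_zero hp hτ₀ hreg le_rfl
    (memLp_of_continuousOn (continuousOn_const (c := -app A.toFun x)))
  exact ⟨_, _, by simpa using (Sol.const (mem_graph_app hx)).add hp h⟩

variable [IsScalarTower ℝ 𝕜 X]

/-- Uniqueness on shorter intervals: the difference of two solutions, preceded by a period of rest,
solves the homogeneous problem on the whole of `[0, τ₀]`. -/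
theorem Sol.unique (hp : 1 ≤ p) (hτ₀ : 0 < τ₀) (hreg : HasMaximalRegularity A p τ₀)
    {δ : ℝ} (hδ0 : 0 ≤ δ) (hδ : δ ≤ τ₀) {g u u' y y' : ℝ → X} {x : X}
    (h : Sol A p δ g x u y) (h' : Sol A p δ g x u' y') : EqOn u u' (Icc 0 δ) := by
  have h1 : Sol A p δ (fun _ => 0) 0 (fun t => u t - u' t) (fun t => y t - y' t) := by
    simpa using h.sub hp h'
  have h2 : Sol A p (τ₀ - δ + δ) _ 0 _ _ :=
    (Sol.zero (A := A) (p := p) (τ := τ₀ - δ)).glue hp (by linarith) h1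
  have e : MaxReg.glue (τ₀ - δ) (fun _ => (0 : X)) (fun _ => 0) = fun _ => 0 := by
    ext t; simp [MaxReg.glue]
  rw [sub_add_cancel, e] at h2
  obtain ⟨w, -, hw⟩ := hreg (fun _ => 0) MemLp.zero'
  have h3 := hw _ ((isStrongSolution_iff hp hτ₀).2 ⟨_, h2⟩)
  have h4 := hw _ ((isStrongSolution_iff hp hτ₀).2 ⟨_, Sol.zero⟩)
  intro t ht
  rcases ht.1.eq_or_lt with h0 | h0
  · rw [← h0, h.initial hδ0, h'.initial hδ0]
  · have hm : τ₀ - δ + t ∈ Icc 0 τ₀ := ⟨by linarith, by linarith [ht.2]⟩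
    have := (h3 hm).trans (h4 hm).symm
    rw [glue_of_lt (by linarith), add_sub_cancel_left] at this
    exact sub_eq_zero.1 this

/-- The a priori estimate of maximal regularity, with a constant that does not depend on the
length of the time interval. It comes from the closed graph theorem in `L^p`. -/
theorem exists_img_bound (hp : 1 ≤ p) (hτ₀ : 0 < τ₀) (hA : A.IsClosed)
    (hreg : HasMaximalRegularity A p τ₀) :
    ∃ K : ℝ≥0, ∀ δ, 0 ≤ δ → δ ≤ τ₀ → ∀ g u y : ℝ → X, Sol A p δ g 0 u y →
      eLpNorm y p (timeMeasure δ) ≤ K * eLpNorm g p (timeMeasure δ) := by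
  have : Fact (1 ≤ p) := ⟨hp⟩
  have hex : ∀ f : Lp X p (timeMeasure τ₀), ∃ q : (ℝ → X) × (ℝ → X), Sol A p τ₀ f 0 q.1 q.2 :=
    fun f => by
      obtain ⟨u, y, h⟩ := exists_sol_zero hp hτ₀ hreg le_rfl (Lp.memLp f)
      exact ⟨(u, y), h⟩
  choose q hq using hex
  have key : ∀ (f : Lp X p (timeMeasure τ₀)) (u y : ℝ → X), Sol A p τ₀ f 0 u y →
      (q f).2 =ᵐ[timeMeasure τ₀] y := fun f u y h =>
    (hq f).img_ae_eq h ((hq f).unique hp hτ₀ hreg hτ₀.le le_rfl h)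
  let S : Lp X p (timeMeasure τ₀) →ₗ[𝕜] Lp X p (timeMeasure τ₀) :=
    { toFun := fun f => (hq f).memLp_img.toLp _
      map_add' := fun f g => by
        rw [← MemLp.toLp_add, MemLp.toLp_eq_toLp_iff]
        have h := (hq f).add hp (hq g)
        rw [add_zero] at h
        exact key _ _ _ (h.congr_rhs (Lp.coeFn_add f g).symm)
      map_smul' := fun c f => by
        rw [RingHom.id_apply, ← MemLp.toLp_const_smul, MemLp.toLp_eq_toLp_iff]
        have h := (hq f).smul c
        rw [smul_zero] at h
        exact key _ _ _ (h.congr_rhs (Lp.coeFn_smul c f).symm) }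
  have hS : Continuous S := by
    refine S.continuous_of_seq_closed_graph fun f f₀ z hf hz => ?_
    have hint : ∀ (h : ℕ → Lp X p (timeMeasure τ₀)) (h₀ : Lp X p (timeMeasure τ₀)),
        Tendsto h atTop (𝓝 h₀) → ∀ t ∈ Icc 0 τ₀,
        Tendsto (fun n => ∫ s in (0 : ℝ)..t, h n s) atTop (𝓝 (∫ s in (0 : ℝ)..t, h₀ s)) := by
      intro h h₀ hh t ht
      have h1 := (Lp.tendsto_Lp_iff_tendsto_eLpNorm' _ _).1 hh
      have iI : ∀ k : Lp X p (timeMeasure τ₀), IntervalIntegrable k volume 0 t := fun k =>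
        intervalIntegrable_of_integrableOn (integrableOn_of_memLp hp (Lp.memLp k)) le_rfl ht.1 ht.2
      rw [tendsto_iff_edist_tendsto_0]
      have h2 : Tendsto (fun n => eLpNorm (⇑(h n) - ⇑h₀) p (timeMeasure τ₀) *
          ENNReal.ofReal t ^ (1 - 1 / p.toReal))
              atTop (𝓝 (0 * ENNReal.ofReal t ^ (1 - 1 / p.toReal))) :=
        ENNReal.Tendsto.mul_const h1 (Or.inr (ENNReal.rpow_ne_top_of_nonneg
          (one_sub_one_div_toReal_nonneg hp) ENNReal.ofReal_ne_top))
      rw [zero_mul] at h2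
      refine tendsto_of_tendsto_of_tendsto_of_le_of_le tendsto_const_nhds h2 (fun _ => zero_le)
        fun n => ?_
      simp only
      rw [edist_eq_enorm_sub, ← intervalIntegral.integral_sub (iI _) (iI _)]
      refine (enorm_integral_le hp ht.1 (((Lp.memLp (h n)).sub (Lp.memLp h₀)).mono_measure
        (timeMeasure_mono ht.2)).aestronglyMeasurable).trans ?_
      gcongr
      exact timeMeasure_mono ht.2
    have hyae : ∀ n, (S (f n) : ℝ → X) =ᵐ[timeMeasure τ₀] (q (f n)).2 := fun n =>
      (hq (f n)).memLp_img.coeFn_toLp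
    obtain ⟨ns, hns, hlim⟩ := (tendstoInMeasure_of_tendsto_Lp hz).exists_seq_tendsto_ae
    have hsol : Sol A p τ₀ f₀ 0 (fun t => 0 + ∫ s in (0 : ℝ)..t, (f₀ s - z s)) z := by
      refine ⟨Lp.memLp _, Lp.memLp _, fun t _ => rfl, ?_⟩
      have h1 : ∀ᵐ t ∂timeMeasure τ₀, ∀ n, ((q (f n)).1 t, (q (f n)).2 t) ∈ A.graph :=
        ae_all_iff.2 fun n => (hq (f n)).graph
      filter_upwards [hlim, h1, ae_all_iff.2 hyae, ae_restrict_mem measurableSet_Icc]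
        with t ht1 ht2 ht3 hm
      have iI : ∀ k : Lp X p (timeMeasure τ₀), IntervalIntegrable k volume 0 t := fun k =>
        intervalIntegrable_of_integrableOn (integrableOn_of_memLp hp (Lp.memLp k)) le_rfl hm.1 hm.2
      have h4 : Tendsto (fun n => (q (f n)).1 t) atTop
          (𝓝 (0 + ∫ s in (0 : ℝ)..t, (f₀ s - z s))) := by
        have h5 := (hint _ _ hf t hm).sub (hint _ _ hz t hm)
        rw [zero_add, intervalIntegral.integral_sub (iI _) (iI _)]
        refine h5.congr fun n => ?_
        rw [(hq (f n)).eq t hm, zero_add, ← intervalIntegral.integral_sub (iI _) (iI _)]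
        refine intervalIntegral.integral_congr_ae ?_
        rw [uIoc_of_le hm.1]
        filter_upwards [(ae_restrict_iff' measurableSet_Icc).1 (hyae n)] with s hs hs'
        rw [← hs ⟨hs'.1.le, hs'.2.trans hm.2⟩]
        rfl
      have h6 := (h4.comp hns.tendsto_atTop).prodMk_nhds ht1
      refine IsClosed.mem_of_tendsto (show IsClosed (A.graph : Set (X × X)) from hA) h6
          (Eventually.of_forall fun n => ?_)
      simp only [Function.comp_apply, ht3 (ns n)]
      exact ht2 (ns n)
    have h7 := key f₀ _ _ hsol
    refine Lp.ext ?_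
    exact h7.symm.trans (hq f₀).memLp_img.coeFn_toLp.symm
  let S' : Lp X p (timeMeasure τ₀) →L[𝕜] Lp X p (timeMeasure τ₀) := ⟨S, hS⟩
  refine ⟨‖S'‖₊, fun δ hδ0 hδ g u y h => ?_⟩
  have e : (timeMeasure τ₀).restrict (Icc 0 δ) = timeMeasure δ := by
    rw [timeMeasure, Measure.restrict_restrict measurableSet_Icc,
      inter_eq_left.2 (Icc_subset_Icc_right hδ)]
  have hg' : MemLp ((Icc 0 δ).indicator g) p (timeMeasure τ₀) := by
    rw [memLp_indicator_iff_restrict measurableSet_Icc, e]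
    exact h.memLp_rhs
  have h1 := (hq (hg'.toLp _)).mono hδ
  have h2 : y =ᵐ[timeMeasure δ] (q (hg'.toLp _)).2 := by
    have hh : (hg'.toLp _ : ℝ → X) =ᵐ[timeMeasure δ] g := by
      have := ae_mono (timeMeasure_mono hδ) hg'.coeFn_toLp
      filter_upwards [this, ae_restrict_mem measurableSet_Icc] with t ht hm
      rw [ht, indicator_of_mem hm]
    have h1' := h1.congr_rhs hh
    exact h.img_ae_eq h1' (h.unique hp hτ₀ hreg hδ0 hδ h1')
  have h3 : ‖S' (hg'.toLp _)‖ₑ = eLpNorm (q (hg'.toLp _)).2 p (timeMeasure τ₀) :=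
    Lp.enorm_toLp (hq _).memLp_img
  have h4 : ‖hg'.toLp _‖ₑ = eLpNorm g p (timeMeasure δ) := by
    rw [Lp.enorm_toLp, eLpNorm_indicator_eq_eLpNorm_restrict measurableSet_Icc, e]
  rw [eLpNorm_congr_ae h2, ← h4]
  exact (eLpNorm_mono_measure _ (timeMeasure_mono hδ)).trans (h3 ▸ S'.le_opENorm _)

end Regularity
/-! ### Boundedness of orbits -/

section Generation

variable {𝕜 X : Type*} [RCLike 𝕜] [NormedAddCommGroup X] [NormedSpace 𝕜 X]
  [NormedSpace ℝ X] [IsScalarTower ℝ 𝕜 X] [CompleteSpace X] {A : X →ₗ.[𝕜] X} {p : ℝ≥0∞} {τ₀ : ℝ}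

/-- The primitive of an orbit starting at `x` solves the problem with constant right-hand side `x`.
This bounds the orbit in `L^p` by the norm of its initial value. -/
theorem Sol.primitive (hA : A.IsClosed) (hp : 1 ≤ p) {δ : ℝ} (hδ : 0 ≤ δ) {x : X} {u y : ℝ → X}
    (h : Sol A p δ (fun _ => 0) x u y) :
    Sol A p δ (fun _ => x) 0 (fun t => ∫ s in (0 : ℝ)..t, u s) (fun t => x - u t) where
  memLp_rhs := memLp_of_continuousOn continuousOn_const
  memLp_img := memLp_of_continuousOn (continuousOn_const.sub (h.continuousOn hp hδ))
  eq t _ := by simp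
  graph := by
    filter_upwards [ae_restrict_mem measurableSet_Icc] with t ht
    rw [h.eq_sub_integral ht, sub_sub_cancel]
    refine intervalIntegral_mem_graph hA ht.1
      (intervalIntegrable_of_integrableOn (h.continuousOn hp hδ).integrableOn_Icc le_rfl ht.1 ht.2)
      (intervalIntegrable_of_integrableOn (integrableOn_of_memLp hp h.memLp_img)
          le_rfl ht.1 ht.2) ?_
    exact ae_mono (Measure.restrict_mono (Ioc_subset_Icc_self.trans (Icc_subset_Icc_right ht.2))
      le_rfl) h.graph

/-- If `u` is an orbit then `t ↦ t u(t)` solves the problem with right-hand side `u` and initial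
value `0`. This recovers pointwise bounds for `u` from its `L^p` bounds. -/
theorem Sol.time_smul (hp : 1 ≤ p) {δ : ℝ} (hδ : 0 ≤ δ) {x : X} {u y : ℝ → X}
    (h : Sol A p δ (fun _ => 0) x u y) :
    Sol A p δ u 0 (fun t => t • u t) (fun t => t • y t) where
  memLp_rhs := memLp_of_continuousOn (h.continuousOn hp hδ)
  memLp_img := by
    refine MemLp.of_le_mul (c := δ) h.memLp_img
      (continuous_id.aestronglyMeasurable.smul h.memLp_img.aestronglyMeasurable) ?_
    filter_upwards [ae_restrict_mem measurableSet_Icc] with t ht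
    rw [norm_smul, Real.norm_of_nonneg ht.1]
    exact mul_le_mul_of_nonneg_right ht.2 (norm_nonneg _)
  eq t ht := by
    have hyi := (integrableOn_of_memLp hp h.memLp_img)
    have iy : IntervalIntegrable y volume 0 t :=
      intervalIntegrable_of_integrableOn hyi le_rfl ht.1 ht.2
    have iu : IntervalIntegrable u volume 0 t :=
      intervalIntegrable_of_integrableOn (h.continuousOn hp hδ).integrableOn_Icc le_rfl ht.1 ht.2
    have isy : IntervalIntegrable (fun s => s • y s) volume 0 t :=
      iy.continuousOn_smul continuousOn_id
    have key := integral_clm_primitive (fun _ => ContinuousLinearMap.id ℝ X) continuous_snd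
      (M := ‖ContinuousLinearMap.id ℝ X‖) (fun _ => le_rfl) ht.1 iy.1
    simp only [ContinuousLinearMap.id_apply, intervalIntegral.integral_const, sub_smul] at key
    have ity : IntervalIntegrable (fun s => t • y s) volume 0 t := iy.smul t
    rw [intervalIntegral.integral_sub ity isy, intervalIntegral.integral_smul] at key
    have e : ∫ s in (0 : ℝ)..t, u s = t • x - ∫ s in (0 : ℝ)..t, ∫ σ in (0 : ℝ)..s, y σ := by
      have ic : IntervalIntegrable (fun s => ∫ σ in (0 : ℝ)..s, y σ) volume 0 t := by
        refine ContinuousOn.intervalIntegrable ?_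
        exact intervalIntegral.continuousOn_primitive_interval' iy left_mem_uIcc
      rw [← sub_zero t, ← intervalIntegral.integral_const, sub_zero,
        ← intervalIntegral.integral_sub (by simp) ic]
      refine intervalIntegral.integral_congr fun s hs => ?_
      rw [uIcc_of_le ht.1] at hs
      exact h.eq_sub_integral ⟨hs.1, hs.2.trans ht.2⟩
    rw [intervalIntegral.integral_sub iu isy, e, key, h.eq_sub_integral ht, smul_sub]
    abel
  graph := by
    filter_upwards [h.graph] with t ht
    exact real_smul_mem_graph t ht

/-- Orbits are bounded by their initial values, in the norm of `X`. -/
theorem exists_orbit_bound (hp : 1 ≤ p) (hp' : p ≠ ⊤) (hτ₀ : 0 < τ₀) (hA : A.IsClosed)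
    (hreg : HasMaximalRegularity A p τ₀) :
    ∃ M : ℝ, 1 ≤ M ∧ ∀ (x : X) (u y : ℝ → X), Sol A p τ₀ (fun _ => 0) x u y →
      ∀ t ∈ Icc 0 τ₀, ‖u t‖ ≤ M * ‖x‖ := by
  obtain ⟨K, hK⟩ := exists_img_bound hp hτ₀ hA hreg
  refine ⟨((1 + K) * (1 + K) : ℝ≥0), ?_, fun x u y h t ht => ?_⟩
  · push_cast
    nlinarith [K.coe_nonneg]
  have hM1 : (1 : ℝ) ≤ ((1 + K) * (1 + K) : ℝ≥0) := by
    push_cast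
    nlinarith [K.coe_nonneg]
  rcases ht.1.eq_or_lt with h0 | h0
  · rw [← h0, h.initial hτ₀.le]
    exact le_mul_of_one_le_left (norm_nonneg _) hM1
  have ht' := h.mono ht.2
  have hp0 : p ≠ 0 := (zero_lt_one.trans_le hp).ne'
  have htr : ENNReal.ofReal t ≠ 0 := by simpa using h0
  -- the `L^p` bound, from the equation solved by the primitive of `u`
  have h1 : eLpNorm u p (timeMeasure t) ≤
      (1 + K) * (‖x‖ₑ * ENNReal.ofReal t ^ (1 / p.toReal)) := by
    have hc : eLpNorm (fun _ : ℝ => x) p (timeMeasure t) =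
        ‖x‖ₑ * ENNReal.ofReal t ^ (1 / p.toReal) := by
      rw [eLpNorm_const' _ hp0 hp']
      simp
    have h2 := hK t ht.1 ht.2 _ _ _ (ht'.primitive hA hp ht.1)
    have e : u = (fun _ => x) - fun s => x - u s := by
      ext s; simp
    have cu := ht'.continuousOn hp ht.1
    calc eLpNorm u p (timeMeasure t)
        = eLpNorm ((fun _ => x) - fun s => x - u s) p (timeMeasure t) := by rw [← e]
      _ ≤ eLpNorm (fun _ => x) p (timeMeasure t) + eLpNorm (fun s => x - u s) p (timeMeasure t) :=
          eLpNorm_sub_le aestronglyMeasurable_const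
            ((continuousOn_const.sub cu).aestronglyMeasurable measurableSet_Icc) hp
      _ ≤ (1 + K) * eLpNorm (fun _ : ℝ => x) p (timeMeasure t) := by
          rw [add_mul, one_mul]; gcongr
      _ = _ := by rw [hc]
  -- the pointwise bound, from the equation solved by `t u(t)`
  have hw := ht'.time_smul hp ht.1
  have h3 : ‖t • u t‖ₑ ≤ (1 + K) * eLpNorm u p (timeMeasure t) *
      ENNReal.ofReal t ^ (1 - 1 / p.toReal) := by
    rw [hw.eq t ⟨ht.1, le_rfl⟩, zero_add]
    refine (enorm_integral_le hp ht.1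
      (hw.memLp_rhs.sub hw.memLp_img).aestronglyMeasurable).trans ?_
    gcongr
    refine (eLpNorm_sub_le hw.memLp_rhs.aestronglyMeasurable
      hw.memLp_img.aestronglyMeasurable hp).trans ?_
    rw [add_mul, one_mul]
    gcongr
    exact hK t ht.1 ht.2 _ _ _ hw
  have h4 : ENNReal.ofReal t * ‖u t‖ₑ ≤
      ENNReal.ofReal t * (((1 + K) * (1 + K) : ℝ≥0) * ‖x‖ₑ) := by
    calc ENNReal.ofReal t * ‖u t‖ₑ = ‖t • u t‖ₑ := by
          rw [enorm_smul, Real.enorm_of_nonneg ht.1]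
      _ ≤ _ := h3
      _ ≤ (1 + K) * ((1 + K) * (‖x‖ₑ * ENNReal.ofReal t ^ (1 / p.toReal))) *
          ENNReal.ofReal t ^ (1 - 1 / p.toReal) := by gcongr
      _ = ((1 + K) * (1 + K)) * ‖x‖ₑ * (ENNReal.ofReal t ^ (1 / p.toReal) *
          ENNReal.ofReal t ^ (1 - 1 / p.toReal)) := by ring
      _ = ENNReal.ofReal t * (((1 + K) * (1 + K) : ℝ≥0) * ‖x‖ₑ) := by
          rw [← ENNReal.rpow_add _ _ htr ENNReal.ofReal_ne_top, add_sub_cancel, ENNReal.rpow_one]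
          push_cast
          ring
  rw [ENNReal.mul_le_mul_iff_right htr ENNReal.ofReal_ne_top] at h4
  have h5 := ENNReal.toReal_mono (ENNReal.mul_ne_top ENNReal.coe_ne_top enorm_ne_top) h4
  rwa [ENNReal.toReal_mul, ENNReal.coe_toReal, toReal_enorm, toReal_enorm] at h5

/-- Orbits of points of the domain extend, by density, to a bounded and strongly continuous family
of operators. Outside `[0, τ₀]` the family is continued by its boundary values. -/
theorem exists_local_semigroup (hp : 1 ≤ p) (hp' : p ≠ ⊤) (hτ₀ : 0 < τ₀) (hA : A.IsClosed)
    (hd : Dense (A.domain : Set X)) (hreg : HasMaximalRegularity A p τ₀) :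
    ∃ (T : ℝ → X →L[𝕜] X) (M : ℝ≥0), 1 ≤ M ∧ (∀ t, ‖T t‖ ≤ M) ∧
      T 0 = ContinuousLinearMap.id 𝕜 X ∧ (Continuous fun q : X × ℝ => T q.2 q.1) ∧
      ∀ x ∈ A.domain, ∃ y, Sol A p τ₀ (fun _ => 0) x (fun t => T t x) y := by
  obtain ⟨M, hM1, hM⟩ := exists_orbit_bound hp hp' hτ₀ hA hreg
  lift M to ℝ≥0 using zero_le_one.trans hM1
  choose u y hu using fun x : A.domain => exists_orbit hp hτ₀ hreg x.2
  have huniq : ∀ (x : A.domain) (w z : ℝ → X), Sol A p τ₀ (fun _ => 0) x w z →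
      EqOn (u x) w (Icc 0 τ₀) := fun x w z h => (hu x).unique hp hτ₀ hreg hτ₀.le le_rfl h
  let c : ℝ → ℝ := fun t => projIcc 0 τ₀ hτ₀.le t
  have hc : ∀ t, c t ∈ Icc 0 τ₀ := fun t => (projIcc 0 τ₀ hτ₀.le t).2
  have hcc : Continuous c := continuous_subtype_val.comp continuous_projIcc
  have hceq : ∀ t ∈ Icc 0 τ₀, c t = t := fun t ht => by
    simp only [c, projIcc_of_mem hτ₀.le ht]
  let f : ℝ → A.domain →ₗ[𝕜] X := fun t =>
    { toFun := fun x => u x (c t)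
      map_add' := fun x x' => by
        have h := (hu x).add hp (hu x')
        rw [add_zero] at h
        exact huniq (x + x') _ _ h (hc t)
      map_smul' := fun k x => by
        have h := (hu x).smul k
        rw [smul_zero] at h
        exact huniq (k • x) _ _ h (hc t) }
  have hdr : DenseRange A.domain.subtype := by
    simpa [DenseRange] using hd
  have hfb : ∀ t x, ‖f t x‖ ≤ M * ‖A.domain.subtype x‖ := fun t x => hM _ _ _ (hu x) _ (hc t)
  let T : ℝ → X →L[𝕜] X := fun t => (f t).extendOfNorm A.domain.subtype
  have hT : ∀ t (x : A.domain), T t x = u x (c t) := fun t x =>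
    LinearMap.extendOfNorm_eq hdr ⟨M, hfb t⟩ x
  have hTn : ∀ t, ‖T t‖ ≤ M := fun t =>
    LinearMap.opNorm_extendOfNorm_le hdr M.coe_nonneg (hfb t)
  refine ⟨T, M, by exact_mod_cast hM1, hTn, ?_, ?_, fun x hx => ?_⟩
  · refine LinearMap.extendOfNorm_unique hdr M (hfb 0) _ ?_
    ext x
    change (x : X) = u x (c 0)
    rw [hceq 0 ⟨le_rfl, hτ₀.le⟩, (hu x).initial hτ₀.le]
  · refine continuous_prod_of_dense_continuous_lipschitzWith _ M hd (fun x hx => ?_) fun t => ?_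
    · have := ((hu ⟨x, hx⟩).continuousOn hp hτ₀.le).comp_continuous hcc hc
      exact this.congr fun t => (hT t ⟨x, hx⟩).symm
    · exact (T t).lipschitz.weaken (by exact_mod_cast hTn t)
  · refine ⟨y ⟨x, hx⟩, (hu ⟨x, hx⟩).memLp_rhs, (hu ⟨x, hx⟩).memLp_img, fun t ht => ?_, ?_⟩
    · rw [← (hu ⟨x, hx⟩).eq t ht, hT t ⟨x, hx⟩, hceq t ht]
    · filter_upwards [(hu ⟨x, hx⟩).graph, ae_restrict_mem measurableSet_Icc] with t ht hm
      rwa [hT t ⟨x, hx⟩, hceq t hm]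

end Generation
/-! ### The semigroup and its generator -/

section Extend

variable {𝕜 X : Type*} [RCLike 𝕜] [NormedAddCommGroup X] [NormedSpace 𝕜 X]

/-- The extension to `[0, ∞)` of a local semigroup `(T(t))` given on `[0, δ]`:
`T(nδ + r) = T(δ)ⁿ T(r)`. -/
noncomputable def extendSemigroup (δ : ℝ) (T : ℝ → X →L[𝕜] X) (t : ℝ) : X →L[𝕜] X :=
  T δ ^ ⌊t / δ⌋₊ * T (t - ⌊t / δ⌋₊ * δ)

theorem extendSemigroup_apply {δ : ℝ} (hδ : 0 < δ) {T : ℝ → X →L[𝕜] X} (h0 : T 0 = 1) (n : ℕ)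
    {r : ℝ} (hr : r ∈ Icc 0 δ) : extendSemigroup δ T (n * δ + r) = T δ ^ n * T r := by
  rcases hr.2.eq_or_lt with h | h
  · have e : (n * δ + r) / δ = (n + 1 : ℕ) := by
      rw [h]; push_cast; field_simp
    rw [extendSemigroup, e, Nat.floor_natCast, h]
    have : n * δ + δ - (n + 1 : ℕ) * δ = 0 := by push_cast; ring
    rw [this, h0, mul_one, pow_succ]
  · have e : ⌊(n * δ + r) / δ⌋₊ = n := by
      rw [Nat.floor_eq_iff (by have := hr.1; positivity)]
      constructor
      · rw [le_div_iff₀ hδ]; linarith [hr.1]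
      · rw [div_lt_iff₀ hδ]; linarith
    rw [extendSemigroup, e, add_sub_cancel_left]

theorem exists_nat_mul_add {δ : ℝ} (hδ : 0 < δ) {t : ℝ} (ht : 0 ≤ t) :
    ∃ (n : ℕ) (r : ℝ), r ∈ Icc 0 δ ∧ t = n * δ + r := by
  refine ⟨⌊t / δ⌋₊, t - ⌊t / δ⌋₊ * δ, ⟨?_, ?_⟩, by ring⟩
  · have := Nat.floor_le (div_nonneg ht hδ.le)
    rw [le_div_iff₀ hδ] at this
    linarith
  · have := Nat.lt_floor_add_one (t / δ)
    rw [div_lt_iff₀ hδ] at this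
    linarith

theorem isC0Semigroup_extendSemigroup {δ : ℝ} (hδ : 0 < δ) {T : ℝ → X →L[𝕜] X} {M : ℝ≥0}
    (hM1 : 1 ≤ M) (hM : ∀ t, ‖T t‖ ≤ M) (h0 : T 0 = ContinuousLinearMap.id 𝕜 X)
    (hc : ∀ x, Continuous fun t => T t x)
    (hadd : ∀ s t, 0 ≤ s → 0 ≤ t → s + t ≤ δ → T (s + t) = T s * T t) :
    IsC0Semigroup (extendSemigroup δ T) := by
  have h0' : T 0 = 1 := h0
  have happ := fun n r hr => extendSemigroup_apply hδ h0' n (r := r) hr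
  have hcomm : ∀ a ∈ Icc 0 δ, Commute (T a) (T δ) := fun a ha => by
    have e1 := hadd a (δ - a) ha.1 (by linarith [ha.2]) (by linarith)
    have e2 := hadd (δ - a) a (by linarith [ha.2]) ha.1 (by linarith)
    rw [add_sub_cancel] at e1
    rw [sub_add_cancel] at e2
    change T a * T δ = T δ * T a
    nth_rw 1 [e2]
    rw [← mul_assoc, ← e1]
  have hmul : ∀ s t : ℝ, 0 ≤ s → 0 ≤ t →
      extendSemigroup δ T (s + t) = extendSemigroup δ T s * extendSemigroup δ T t := by
    intro s t hs ht
    obtain ⟨m, a, ha, rfl⟩ := exists_nat_mul_add hδ hs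
    obtain ⟨n, b, hb, rfl⟩ := exists_nat_mul_add hδ ht
    have e3 : T δ ^ m * T a * (T δ ^ n * T b) = T δ ^ (m + n) * (T a * T b) := by
      rw [mul_assoc, ← mul_assoc (T a), ((hcomm a ha).pow_right n).eq, pow_add]
      simp only [mul_assoc]
    rw [happ m a ha, happ n b hb, e3]
    rcases le_or_gt (a + b) δ with hab | hab
    · rw [← hadd a b ha.1 hb.1 hab, ← happ (m + n) (a + b) ⟨by linarith [ha.1, hb.1], hab⟩]
      congr 1; push_cast; ring
    · have hr : a + b - δ ∈ Icc 0 δ := ⟨by linarith, by linarith [ha.2, hb.2]⟩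
      have e4 : T b = T (δ - a) * T (a + b - δ) := by
        rw [← hadd (δ - a) (a + b - δ) (by linarith [ha.2]) hr.1 (by linarith [hb.2])]
        congr 1; ring
      have e5 : T a * T (δ - a) = T δ := by
        rw [← hadd a (δ - a) ha.1 (by linarith [ha.2]) (by linarith), add_sub_cancel]
      rw [e4, ← mul_assoc (T a), e5, ← mul_assoc, ← pow_succ, ← happ (m + n + 1) _ hr]
      congr 1; push_cast; ring
  have hloc : ∀ r ∈ Icc 0 δ, extendSemigroup δ T r = T r := fun r hr => by
    simpa using happ 0 r hr
  have hMn : ∀ n : ℕ, ‖T δ ^ n‖ ≤ (M : ℝ) ^ n := fun n => by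
    induction n with
    | zero => simpa using! ContinuousLinearMap.norm_id_le (𝕜 := 𝕜) (E := X)
    | succ k ih =>
      rw [pow_succ, pow_succ]
      exact (norm_mul_le _ _).trans (mul_le_mul ih (hM δ) (norm_nonneg _) (by positivity))
  have hbd : ∀ b t : ℝ, t ≤ b → ‖extendSemigroup δ T t‖ ≤ (M : ℝ) ^ (⌊b / δ⌋₊ + 1) := by
    intro b t hb
    have : ⌊t / δ⌋₊ ≤ ⌊b / δ⌋₊ := Nat.floor_mono (by gcongr)
    refine (norm_mul_le _ _).trans ?_
    rw [pow_succ]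
    refine mul_le_mul ((hMn _).trans (pow_le_pow_right₀ (by exact_mod_cast hM1) this)) (hM _)
      (norm_nonneg _) (by positivity)
  refine ⟨?_, hmul, fun x t₀ ht₀ => ?_⟩
  · rw [hloc 0 ⟨le_rfl, hδ.le⟩, h0]
  · rw [mem_Ici] at ht₀
    set B : ℝ := (M : ℝ) ^ (⌊(t₀ + 1) / δ⌋₊ + 1)
    rw [ContinuousWithinAt, tendsto_iff_norm_sub_tendsto_zero]
    have hlim : Tendsto (fun t => B * ‖T |t - t₀| x - x‖) (𝓝[Ici 0] t₀) (𝓝 0) := by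
      have : Continuous fun t => B * ‖T |t - t₀| x - x‖ :=
        continuous_const.mul
          ((((hc x).comp (by fun_prop : Continuous fun t : ℝ => |t - t₀|)).sub
            continuous_const).norm)
      have h := this.tendsto t₀
      simp only [sub_self, abs_zero, h0, ContinuousLinearMap.id_apply, norm_zero, mul_zero] at h
      exact h.mono_left nhdsWithin_le_nhds
    refine squeeze_zero' (Eventually.of_forall fun _ => norm_nonneg _) ?_ hlim
    have hn : ∀ᶠ t in 𝓝[Ici 0] t₀, |t - t₀| < min 1 δ := by
      refine nhdsWithin_le_nhds ?_
      have : Tendsto (fun t => |t - t₀|) (𝓝 t₀) (𝓝 0) := by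
        have h : Continuous fun t : ℝ => |t - t₀| := by fun_prop
        simpa using h.tendsto t₀
      exact this.eventually_lt_const (by positivity)
    filter_upwards [hn, self_mem_nhdsWithin] with t ht htp
    have ht1 := ht.trans_le (min_le_left _ _)
    have htδ := ht.trans_le (min_le_right _ _)
    rcases le_total t₀ t with hle | hle
    · rw [abs_of_nonneg (by linarith)] at ht1 htδ ⊢
      have e : extendSemigroup δ T t x = extendSemigroup δ T t₀ (T (t - t₀) x) := by
        rw [← hloc (t - t₀) ⟨by linarith, htδ.le⟩, ← mul_apply_eq_comp,
          ← hmul _ _ ht₀ (by linarith), add_sub_cancel]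
      rw [e, ← map_sub]
      exact (ContinuousLinearMap.le_of_opNorm_le _ (hbd (t₀ + 1) t₀ (by linarith)) _)
    · rw [abs_of_nonpos (by linarith)] at ht1 htδ ⊢
      have e : extendSemigroup δ T t₀ x = extendSemigroup δ T t (T (-(t - t₀)) x) := by
        rw [← hloc (-(t - t₀)) ⟨by linarith, htδ.le⟩, ← mul_apply_eq_comp,
          ← hmul _ _ htp (by linarith)]
        congr 2; ring
      rw [e, ← map_sub, ← norm_neg, ← map_neg, neg_sub]
      exact (ContinuousLinearMap.le_of_opNorm_le _ (hbd (t₀ + 1) t (by linarith)) _)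

end Extend

section Generator

variable {𝕜 X : Type*} [RCLike 𝕜] [NormedAddCommGroup X] [NormedSpace 𝕜 X]
  {A : X →ₗ.[𝕜] X}

theorem mem_neg_graph {x w : X} : (x, w) ∈ (-A).graph ↔ (x, -w) ∈ A.graph := by
  rw [LinearPMap.neg_graph, Submodule.mem_map]
  constructor
  · rintro ⟨⟨a, b⟩, hab, h⟩
    simp only [LinearMap.prodMap_apply, LinearMap.id_coe, id_eq, LinearMap.neg_apply,
      Prod.mk.injEq] at h
    obtain ⟨rfl, rfl⟩ := h
    rwa [neg_neg]
  · exact fun h => ⟨_, h, by simp⟩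

variable [NormedSpace ℝ X] [IsScalarTower ℝ 𝕜 X] [CompleteSpace X] {p : ℝ≥0∞} {τ₀ : ℝ}

/-- A family of operators that satisfies the integrated form of `T' = -AT = -TA` near `0` has the
infinitesimal generator `-A`. -/
theorem isGenerator_of_integral (hA : A.IsClosed) (hτ₀ : 0 < τ₀) {T : ℝ → X →L[𝕜] X}
    (hc : ∀ x, Continuous fun t => T t x) (h0 : T 0 = ContinuousLinearMap.id 𝕜 X)
    (h1 : ∀ x, ∀ t ∈ Icc 0 τ₀, (∫ s in (0 : ℝ)..t, T s x, x - T t x) ∈ A.graph)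
    (h2 : ∀ x z, (x, z) ∈ A.graph → ∀ t ∈ Icc 0 τ₀, T t x = x - ∫ s in (0 : ℝ)..t, T s z) :
    IsGenerator (-A) T := by
  have hder : ∀ x, Tendsto (fun t : ℝ => t⁻¹ • ∫ s in (0 : ℝ)..t, T s x) (𝓝[>] 0) (𝓝 x) := by
    intro x
    have := ((hc x).integral_hasStrictDerivAt 0 0).hasDerivAt.tendsto_slope_zero_right
    simpa [h0] using this
  have hmem : ∀ᶠ t : ℝ in 𝓝[>] 0, t ∈ Icc 0 τ₀ := by
    filter_upwards [Ioc_mem_nhdsGT hτ₀] with t ht using Ioc_subset_Icc_self ht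
  intro x w
  rw [mem_neg_graph]
  constructor
  · intro h
    have h3 := hder (-w)
    rw [← tendsto_neg_iff, neg_neg] at h3
    refine h3.congr' ?_
    filter_upwards [hmem] with t ht
    rw [h2 x _ h t ht, sub_sub_cancel_left, smul_neg]
  · intro h
    have h3 := (hder x).prodMk_nhds (h.neg)
    refine IsClosed.mem_of_tendsto (show IsClosed (A.graph : Set (X × X)) from hA) h3 ?_
    filter_upwards [hmem] with t ht
    have h4 := real_smul_mem_graph t⁻¹ (h1 x t ht)
    rwa [← neg_sub, smul_neg] at h4

/-- Maximal regularity of `A` implies that `-A` generates a strongly continuous semigroup. -/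
theorem exists_semigroup (hp : 1 ≤ p) (hp' : p ≠ ⊤) (hτ₀ : 0 < τ₀) (hA : A.IsClosed)
    (hd : Dense (A.domain : Set X)) (hreg : HasMaximalRegularity A p τ₀) :
    ∃ T : ℝ → X →L[𝕜] X, IsC0Semigroup T ∧ IsGenerator (-A) T := by
  obtain ⟨T, M, hM1, hM, h0, hjc, hsol⟩ := exists_local_semigroup hp hp' hτ₀ hA hd hreg
  have hc : ∀ x, Continuous fun t => T t x := fun x =>
    hjc.comp (continuous_const.prodMk continuous_id)
  have ii : ∀ x a b, IntervalIntegrable (fun s => T s x) volume a b := fun x a b =>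
    (hc x).intervalIntegrable _ _
  have hgraph : ∀ x, ∀ t ∈ Icc 0 τ₀, (∫ s in (0 : ℝ)..t, T s x, x - T t x) ∈ A.graph := by
    intro x t ht
    have hcont : Continuous fun x : X => (∫ s in (0 : ℝ)..t, T s x, x - T t x) := by
      refine Continuous.prodMk ?_ (continuous_id.sub (T t).continuous)
      exact intervalIntegral.continuous_parametric_intervalIntegral_of_continuous' hjc 0 t
    have hcl : IsClosed {x : X | (∫ s in (0 : ℝ)..t, T s x, x - T t x) ∈ A.graph} :=
      (show IsClosed (A.graph : Set (X × X)) from hA).preimage hcont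
    have hsub : closure (A.domain : Set X) ⊆
        {x : X | (∫ s in (0 : ℝ)..t, T s x, x - T t x) ∈ A.graph} := by
      refine hcl.closure_subset_iff.2 fun x hx => ?_
      obtain ⟨y, hy⟩ := hsol x hx
      have e := hy.eq_sub_integral ht
      simp only [mem_ofPred_eq]
      rw [e, sub_sub_cancel]
      refine intervalIntegral_mem_graph hA ht.1 (ii x 0 t)
        (intervalIntegrable_of_integrableOn (integrableOn_of_memLp hp hy.memLp_img) le_rfl ht.1
          ht.2) ?_
      exact ae_mono (Measure.restrict_mono (Ioc_subset_Icc_self.trans (Icc_subset_Icc_right ht.2))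
        le_rfl) hy.graph
    exact hsub (hd.closure_eq ▸ mem_univ x)
  have hform : ∀ x z, (x, z) ∈ A.graph → ∀ t ∈ Icc 0 τ₀,
      T t x = x - ∫ s in (0 : ℝ)..t, T s z := by
    intro x z hxz t ht
    obtain ⟨y, hy⟩ := hsol x (LinearPMap.mem_domain_of_mem_graph hxz)
    have hw : Sol A p τ₀ (fun _ => 0) x (fun t => x - ∫ s in (0 : ℝ)..t, T s z)
        (fun t => T t z) := by
      refine ⟨MemLp.zero', memLp_of_continuousOn (hc z).continuousOn, fun t _ => ?_, ?_⟩
      · simp only [zero_sub, intervalIntegral.integral_neg]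
        abel
      · filter_upwards [ae_restrict_mem measurableSet_Icc] with t ht
        have := A.graph.sub_mem hxz (hgraph z t ht)
        simpa using this
    exact hy.unique hp hτ₀ hreg hτ₀.le le_rfl hw ht
  have hinv : ∀ x z, (x, z) ∈ A.graph → ∀ t ∈ Icc 0 τ₀, (T t x, T t z) ∈ A.graph := by
    intro x z hxz t ht
    rw [hform x z hxz t ht]
    simpa using A.graph.sub_mem hxz (hgraph z t ht)
  have hadd : ∀ s t, 0 ≤ s → 0 ≤ t → s + t ≤ τ₀ → T (s + t) = T s * T t := by
    intro s t hs ht hst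
    refine ContinuousLinearMap.ext_on (s := (A.domain : Set X))
      (hd.mono Submodule.subset_span) fun x hx => ?_
    obtain ⟨y, hy⟩ := hsol x hx
    have hy' : Sol A p (t + (τ₀ - t)) _ _ _ _ := (add_sub_cancel t τ₀).symm ▸ hy
    have h1 := hy'.shift hp ht
    obtain ⟨z, hz⟩ := hsol (T t x)
      (LinearPMap.mem_domain_of_mem_graph (hinv x _ (mem_graph_app hx) t ⟨ht, by linarith⟩))
    have h2 := h1.unique hp hτ₀ hreg (by linarith) (by linarith)
      (hz.mono (b := τ₀ - t) (by linarith))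
    have h3 := h2 (show s ∈ Icc 0 (τ₀ - t) from ⟨hs, by linarith⟩)
    rw [add_comm s t]
    exact h3
  refine ⟨extendSemigroup τ₀ T, isC0Semigroup_extendSemigroup hτ₀ hM1 hM h0 hc hadd, ?_⟩
  have hgen := isGenerator_of_integral hA hτ₀ hc h0 hgraph hform
  intro x w
  rw [hgen x w]
  refine tendsto_congr' ?_
  filter_upwards [Ioc_mem_nhdsGT hτ₀] with t ht
  have := extendSemigroup_apply hτ₀ (show T 0 = 1 from h0) 0 (Ioc_subset_Icc_self ht)
  simp only [Nat.cast_zero, zero_mul, zero_add, pow_zero, one_mul] at this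
  rw [this]

theorem expNeg_spec (hp : 1 ≤ p) (hp' : p ≠ ⊤) (hτ₀ : 0 < τ₀) (hA : A.IsClosed)
    (hd : Dense (A.domain : Set X)) (hreg : HasMaximalRegularity A p τ₀) :
    IsC0Semigroup (expNeg A) ∧ IsGenerator (-A) (expNeg A) := by
  have h := exists_semigroup hp hp' hτ₀ hA hd hreg
  rw [expNeg, dif_pos h]
  exact h.choose_spec

end Generator
/-! ### Strongly continuous semigroups and integrated solutions -/

section Semigroup

/-- The retraction of the real line onto `[0, τ]`. -/
def clamp (τ r : ℝ) : ℝ := max 0 (min τ r)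

theorem clamp_mem {τ : ℝ} (hτ : 0 ≤ τ) (r : ℝ) : clamp τ r ∈ Icc 0 τ :=
  ⟨le_max_left _ _, max_le hτ (min_le_left _ _)⟩

theorem clamp_of_mem {τ r : ℝ} (h : r ∈ Icc 0 τ) : clamp τ r = r := by
  rw [clamp, min_eq_right h.2, max_eq_right h.1]

theorem continuous_clamp (τ : ℝ) : Continuous (clamp τ) := by
  unfold clamp; fun_prop

variable {𝕜 X : Type*} [RCLike 𝕜] [NormedAddCommGroup X] [NormedSpace 𝕜 X]
  {A : X →ₗ.[𝕜] X} {S : ℝ → X →L[𝕜] X}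

theorem IsC0Semigroup.exists_bound [CompleteSpace X] (hS : IsC0Semigroup S) (τ : ℝ) :
    ∃ M : ℝ≥0, ∀ t ∈ Icc 0 τ, ‖S t‖ ≤ M := by
  obtain ⟨M, hM⟩ := banach_steinhaus (g := fun t : Icc 0 τ => S t) fun x => by
    obtain ⟨C, hC⟩ := isCompact_Icc.exists_bound_of_continuousOn
      ((hS.continuousOn x).mono (Icc_subset_Ici_self : Icc 0 τ ⊆ Ici 0))
    exact ⟨C, fun t => hC t t.2⟩
  exact ⟨M.toNNReal, fun t ht => (hM ⟨t, ht⟩).trans (Real.le_coe_toNNReal M)⟩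

/-- Strong continuity and local boundedness make the action of the semigroup jointly continuous. -/
theorem IsC0Semigroup.continuous_clamp [CompleteSpace X] (hS : IsC0Semigroup S) {τ : ℝ}
    (hτ : 0 ≤ τ) : Continuous fun q : ℝ × X => S (clamp τ q.1) q.2 := by
  obtain ⟨M, hM⟩ := hS.exists_bound τ
  have h : Continuous fun q : X × ℝ => S (clamp τ q.2) q.1 :=
    continuous_prod_of_continuous_lipschitzWith _ M
      (fun x => (hS.continuousOn x).comp_continuous (MaxReg.continuous_clamp τ)
        fun r => (clamp_mem hτ r).1)
      fun r => (S (clamp τ r)).lipschitz.weaken (by exact_mod_cast hM _ (clamp_mem hτ r))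
  exact h.comp continuous_swap

theorem IsC0Semigroup.intervalIntegrable_convolution [CompleteSpace X] (hS : IsC0Semigroup S)
    {τ : ℝ} {f : ℝ → X}
    (hf : IntegrableOn f (Icc 0 τ)) {t : ℝ} (ht : t ∈ Icc 0 τ) :
    IntervalIntegrable (fun s => S (t - s) (f s)) volume 0 t := by
  obtain ⟨M, hM⟩ := hS.exists_bound τ
  have hτ := ht.1.trans ht.2
  rw [intervalIntegrable_iff_integrableOn_Ioc_of_le ht.1]
  have hf' : IntegrableOn f (Ioc 0 t) :=
    hf.mono_set (Ioc_subset_Icc_self.trans (Icc_subset_Icc_right ht.2))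
  have h1 : IntegrableOn (fun s => S (clamp τ (t - s)) (f s)) (Ioc 0 t) := by
    refine Integrable.mono' (hf'.norm.const_mul M) ?_ (Eventually.of_forall fun s => ?_)
    · exact (hS.continuous_clamp hτ).comp_aestronglyMeasurable
        ((continuous_const.sub continuous_id).aestronglyMeasurable.prodMk hf'.aestronglyMeasurable)
    · exact ContinuousLinearMap.le_of_opNorm_le _ (hM _ (clamp_mem hτ _)) _
  refine h1.congr_fun (fun s hs => ?_) measurableSet_Ioc
  simp only [clamp_of_mem (show t - s ∈ Icc 0 τ from
      ⟨by linarith [hs.2], by linarith [hs.1, ht.2]⟩)]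

theorem IsGenerator.mem_graph [NormedSpace ℝ X] [IsScalarTower ℝ 𝕜 X] (hS : IsC0Semigroup S)
    (hG : IsGenerator (-A) S) {x z : X} (h : (x, z) ∈ A.graph) {t : ℝ} (ht : 0 ≤ t) :
    (S t x, S t z) ∈ A.graph := by
  have h1 := (hG x (-z)).1 (mem_neg_graph.2 (by rwa [neg_neg]))
  have h2 : (S t x, -S t z) ∈ (-A).graph := by
    refine (hG _ _).2 ?_
    have h3 := ((S t).continuous.tendsto _).comp h1
    rw [map_neg] at h3
    refine h3.congr' ?_
    filter_upwards [self_mem_nhdsWithin] with s hs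
    have hs' : (0 : ℝ) ≤ s := le_of_lt hs
    have e : S s (S t x) = S t (S s x) := by
      have := congrArg (fun L => L x) ((hS.add s t hs' ht).symm.trans
        ((add_comm s t).symm ▸ hS.add t s ht hs'))
      exact this
    rw [Function.comp_apply, e, ← map_sub]
    exact ((S t).restrictScalars ℝ).map_smul _ _
  simpa using mem_neg_graph.1 h2

variable [NormedSpace ℝ X] [IsScalarTower ℝ 𝕜 X] [CompleteSpace X]

/-- The integrated form of `S' = -SA` on the domain of `A`. -/
theorem IsGenerator.eq_sub_integral (hS : IsC0Semigroup S) (hG : IsGenerator (-A) S) {x z : X}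
    (h : (x, z) ∈ A.graph) {t : ℝ} (ht : 0 ≤ t) :
    S t x = x - ∫ s in (0 : ℝ)..t, S s z := by
  have hcont : ∀ w, ContinuousOn (fun s => S s w) (Icc 0 t) := fun w =>
    (hS.continuousOn w).mono Icc_subset_Ici_self
  have h1 := (hG x (-z)).1 (mem_neg_graph.2 (by rwa [neg_neg]))
  have hder : ∀ s ∈ Ioo 0 t, HasDerivWithinAt (fun s => S s x) (-(S s z)) (Ioi s) s := by
    intro s hs
    rw [hasDerivWithinAt_iff_tendsto_slope' (by simp)]
    have h3 := ((S s).continuous.tendsto _).comp h1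
    rw [map_neg] at h3
    have hsub : Tendsto (fun r => r - s) (𝓝[>] s) (𝓝[>] 0) := by
      refine tendsto_nhdsWithin_iff.2 ⟨?_, ?_⟩
      · have : Continuous fun r : ℝ => r - s := by fun_prop
        simpa using (this.tendsto s).mono_left nhdsWithin_le_nhds
      · filter_upwards [self_mem_nhdsWithin] with r hr
        exact sub_pos.2 (mem_Ioi.1 hr)
    refine (h3.comp hsub).congr' ?_
    filter_upwards [self_mem_nhdsWithin] with r hr
    have hr' : 0 ≤ r - s := sub_nonneg.2 (le_of_lt hr)
    have e : S r x = S s (S (r - s) x) := by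
      have := hS.add s (r - s) hs.1.le hr'
      rw [add_sub_cancel] at this
      rw [this]; rfl
    rw [slope_def_module, e, ← map_sub]
    exact ((S s).restrictScalars ℝ).map_smul _ _
  have key := intervalIntegral.integral_eq_sub_of_hasDeriv_right_of_le ht (hcont x)
    (f' := fun s => -(S s z)) hder
    (ContinuousOn.intervalIntegrable (by rw [uIcc_of_le ht]; exact (hcont z).neg))
  rw [intervalIntegral.integral_neg, hS.zero, ContinuousLinearMap.id_apply] at key
  rw [sub_eq_add_neg, key]
  abel

/-- The variation of constants formula, integrated once in time. -/
theorem Sol.integral_eq {p : ℝ≥0∞} (hp : 1 ≤ p) (hS : IsC0Semigroup S) (hG : IsGenerator (-A) S)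
    {τ : ℝ} {g u y : ℝ → X} {x : X} (h : Sol A p τ g x u y) {t : ℝ} (ht : t ∈ Icc 0 τ) :
    ∫ s in (0 : ℝ)..t, u s = (∫ r in (0 : ℝ)..t, S (clamp τ r) x) +
      ∫ s in (0 : ℝ)..t, ∫ r in (0 : ℝ)..(t - s), S (clamp τ r) (g s) := by
  have hτ := ht.1.trans ht.2
  obtain ⟨M, hM⟩ := hS.exists_bound τ
  have hM' : ∀ r, ‖S (clamp τ r)‖ ≤ M := fun r => hM _ (clamp_mem hτ r)
  have hjc := hS.continuous_clamp hτ
  have hcx : ∀ z, Continuous fun r => S (clamp τ r) z := fun z =>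
    hjc.comp (continuous_id.prodMk continuous_const)
  have i0 : ∀ {f : ℝ → X}, IntegrableOn f (Icc 0 τ) → IntervalIntegrable f volume 0 t := fun hf =>
    intervalIntegrable_of_integrableOn hf le_rfl ht.1 ht.2
  have hcu := h.continuousOn hp hτ
  have iu := i0 hcu.integrableOn_Icc
  have hg := integrableOn_of_memLp hp h.memLp_rhs
  have hy := integrableOn_of_memLp hp h.memLp_img
  have iS : ∀ {f : ℝ → X}, IntegrableOn f (Icc 0 τ) →
      IntervalIntegrable (fun s => S (clamp τ (t - s)) (f s)) volume 0 t := fun {f} hf => by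
    refine (hS.intervalIntegrable_convolution hf ht).congr fun s hs => ?_
    rw [uIoc_of_le ht.1] at hs
    simp only [clamp_of_mem (show t - s ∈ Icc 0 τ from
      ⟨by linarith [hs.2], by linarith [hs.1, ht.2]⟩)]
  have iR : ∀ {f : ℝ → X}, IntegrableOn f (Icc 0 τ) → IntervalIntegrable
      (fun s => ∫ r in (0 : ℝ)..(t - s), S (clamp τ r) (f s)) volume 0 t := fun {f} hf => by
    have hR : Continuous fun q : ℝ × X => ∫ r in (0 : ℝ)..q.1, S (clamp τ r) q.2 :=
      intervalIntegral.continuous_parametric_intervalIntegral_of_continuous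
        (f := fun (q : ℝ × X) r => S (clamp τ r) q.2)
        (hjc.comp (continuous_snd.prodMk (continuous_snd.comp continuous_fst))) continuous_fst
    have hf' : IntegrableOn f (Ioc 0 t) := (i0 hf).1
    rw [intervalIntegrable_iff_integrableOn_Ioc_of_le ht.1]
    refine Integrable.mono' (hf'.norm.const_mul (M * t)) ?_ ?_
    · exact hR.comp_aestronglyMeasurable
        ((continuous_const.sub continuous_id).aestronglyMeasurable.prodMk hf'.aestronglyMeasurable)
    · rw [ae_restrict_iff' measurableSet_Ioc]
      refine Eventually.of_forall fun s hs => ?_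
      have h1 := intervalIntegral.norm_integral_le_of_norm_le_const (a := 0) (b := t - s)
        (f := fun r => S (clamp τ r) (f s)) (C := M * ‖f s‖)
        fun r _ => ContinuousLinearMap.le_of_opNorm_le _ (hM' r) _
      rw [sub_zero, abs_of_nonneg (by linarith [hs.2])] at h1
      refine h1.trans ?_
      rw [mul_right_comm]
      gcongr
      linarith [hs.1]
  have key := integral_clm_primitive
    (fun s => (S (clamp τ (t - s))).restrictScalars ℝ)
    (hjc.comp ((continuous_const.sub continuous_fst).prodMk continuous_snd))
    (M := M) (fun s => by simpa using hM' (t - s)) ht.1 (i0 (h.integrableOn hp)).1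
  simp only [ContinuousLinearMap.coe_restrictScalars'] at key
  have e1 : ∫ s in (0 : ℝ)..t, S (clamp τ (t - s)) (u s) =
      (∫ r in (0 : ℝ)..t, S (clamp τ r) x) +
        ∫ s in (0 : ℝ)..t, S (clamp τ (t - s)) (∫ σ in (0 : ℝ)..s, (g σ - y σ)) := by
    have ex := intervalIntegral.integral_comp_sub_left (a := 0) (b := t)
      (fun r => S (clamp τ r) x) t
    rw [sub_self, sub_zero] at ex
    rw [← ex, ← intervalIntegral.integral_add]
    · refine intervalIntegral.integral_congr fun s hs => ?_
      rw [uIcc_of_le ht.1] at hs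
      simp only [h.eq s ⟨hs.1, hs.2.trans ht.2⟩, map_add]
    · exact ((hcx x).comp (continuous_const.sub continuous_id)).intervalIntegrable _ _
    · refine iS (f := fun s => ∫ σ in (0 : ℝ)..s, (g σ - y σ)) ?_
      refine (hcu.sub (continuousOn_const (c := x))).integrableOn_Icc.congr_fun (fun s hs => ?_)
        measurableSet_Icc
      change u s - x = _
      rw [h.eq s hs, add_sub_cancel_left]
  -- for almost all `σ`, `R(t - σ) A u(σ) = u(σ) - S(t - σ) u(σ)`, where `R` is the primitive of `S`
  have e2 : ∫ σ in (0 : ℝ)..t, ∫ s in σ..t, S (clamp τ (t - s)) (g σ - y σ) =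
      ∫ σ in (0 : ℝ)..t, ((∫ r in (0 : ℝ)..(t - σ), S (clamp τ r) (g σ)) -
        (u σ - S (clamp τ (t - σ)) (u σ))) := by
    refine intervalIntegral.integral_congr_ae ?_
    rw [uIoc_of_le ht.1]
    filter_upwards [(ae_restrict_iff' measurableSet_Icc).1 h.graph] with σ hσ hm
    have hgr := hσ ⟨hm.1.le, hm.2.trans ht.2⟩
    have htσ : t - σ ∈ Icc 0 τ := ⟨by linarith [hm.2], by linarith [hm.1, ht.2]⟩
    have ex := intervalIntegral.integral_comp_sub_left (a := σ) (b := t)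
      (fun r => S (clamp τ r) (g σ - y σ)) t
    rw [sub_self] at ex
    rw [ex]
    simp only [map_sub]
    rw [intervalIntegral.integral_sub ((hcx _).intervalIntegrable _ _)
      ((hcx _).intervalIntegrable _ _)]
    congr 1
    rw [clamp_of_mem htσ, hG.eq_sub_integral hS hgr htσ.1, sub_sub_cancel]
    refine intervalIntegral.integral_congr fun r hr => ?_
    rw [uIcc_of_le htσ.1] at hr
    simp only [clamp_of_mem (show r ∈ Icc 0 τ from ⟨hr.1, hr.2.trans htσ.2⟩)]
  rw [key, e2, intervalIntegral.integral_sub (iR hg) (iu.sub (iS hcu.integrableOn_Icc)),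
    intervalIntegral.integral_sub iu (iS hcu.integrableOn_Icc)] at e1
  have e3 : (∫ r in (0 : ℝ)..t, S (clamp τ r) x) +
      (∫ s in (0 : ℝ)..t, ∫ r in (0 : ℝ)..(t - s), S (clamp τ r) (g s)) -
      (∫ s in (0 : ℝ)..t, u s) = 0 := by
    rw [← sub_eq_zero] at e1
    rw [← neg_eq_zero, ← e1]
    abel
  exact (sub_eq_zero.1 e3).symm

end Semigroup
/-! ### Variation of constants -/

section Mild

variable {𝕜 X : Type*} [RCLike 𝕜] [NormedAddCommGroup X] [NormedSpace 𝕜 X]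
  {A : X →ₗ.[𝕜] X} {S : ℝ → X →L[𝕜] X} [NormedSpace ℝ X] [CompleteSpace X]

/-- Differentiation of the convolution of `g` with the primitive of the semigroup. -/
theorem IsC0Semigroup.hasDerivAt_convolution (hS : IsC0Semigroup S) {τ : ℝ} {g : ℝ → X}
    (hg : IntegrableOn g (Icc 0 τ)) {t : ℝ} (ht : t ∈ Icc 0 τ) :
    HasDerivAt (fun t => ∫ σ in Ioc 0 τ, ∫ r in (0 : ℝ)..max (t - σ) 0, S (clamp τ r) (g σ))
      (∫ s in (0 : ℝ)..t, S (t - s) (g s)) t := by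
  have hτ := ht.1.trans ht.2
  obtain ⟨M, hM⟩ := hS.exists_bound τ
  have hM' : ∀ r z, ‖S (clamp τ r) z‖ ≤ M * ‖z‖ := fun r z =>
    ContinuousLinearMap.le_of_opNorm_le _ (hM _ (clamp_mem hτ r)) _
  have hjc := hS.continuous_clamp hτ
  have hcx : ∀ z, Continuous fun r => S (clamp τ r) z := fun z =>
    hjc.comp (continuous_id.prodMk continuous_const)
  have hR : Continuous fun q : ℝ × X => ∫ r in (0 : ℝ)..q.1, S (clamp τ r) q.2 :=
    intervalIntegral.continuous_parametric_intervalIntegral_of_continuous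
      (f := fun (q : ℝ × X) r => S (clamp τ r) q.2)
      (hjc.comp (continuous_snd.prodMk (continuous_snd.comp continuous_fst))) continuous_fst
  have hg' : IntegrableOn g (Ioc 0 τ) := hg.mono_set Ioc_subset_Icc_self
  have hmeas : ∀ t : ℝ, AEStronglyMeasurable
      (fun σ => ∫ r in (0 : ℝ)..max (t - σ) 0, S (clamp τ r) (g σ)) (volume.restrict (Ioc 0 τ)) :=
    fun t => hR.comp_aestronglyMeasurable
      (((continuous_const.sub continuous_id).max continuous_const).aestronglyMeasurable.prodMk
        hg'.aestronglyMeasurable)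
  have hlip : ∀ a b z, ‖(∫ r in (0 : ℝ)..a, S (clamp τ r) z) - ∫ r in (0 : ℝ)..b, S (clamp τ r) z‖
      ≤ M * ‖z‖ * |a - b| := fun a b z => by
    rw [intervalIntegral.integral_interval_sub_left ((hcx z).intervalIntegrable _ _)
      ((hcx z).intervalIntegrable _ _)]
    exact intervalIntegral.norm_integral_le_of_norm_le_const fun r _ => hM' r z
  have hint : Integrable (fun σ => ∫ r in (0 : ℝ)..max (t - σ) 0, S (clamp τ r) (g σ))
      (volume.restrict (Ioc 0 τ)) := by
    refine Integrable.mono' (hg'.norm.const_mul (M * τ)) (hmeas t) ?_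
    rw [ae_restrict_iff' measurableSet_Ioc]
    refine Eventually.of_forall fun σ hσ => ?_
    have := hlip (max (t - σ) 0) 0 (g σ)
    rw [intervalIntegral.integral_same, sub_zero, sub_zero, abs_of_nonneg (le_max_right _ _)] at this
    refine this.trans ?_
    rw [mul_right_comm]
    gcongr
    exact max_le (by linarith [hσ.1, ht.2]) hτ
  have key := hasDerivAt_integral_of_dominated_loc_of_lip (𝕜 := ℝ)
    (μ := volume.restrict (Ioc 0 τ)) (s := univ)
    (F := fun t σ => ∫ r in (0 : ℝ)..max (t - σ) 0, S (clamp τ r) (g σ))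
    (F' := fun σ => (Iio t).indicator (fun σ => S (clamp τ (t - σ)) (g σ)) σ)
    (bound := fun σ => M * ‖g σ‖) (x₀ := t) univ_mem (Eventually.of_forall hmeas) hint
    ((hjc.comp_aestronglyMeasurable
      ((continuous_const.sub continuous_id).aestronglyMeasurable.prodMk
        hg'.aestronglyMeasurable)).indicator measurableSet_Iio) ?_ (hg'.norm.const_mul M) ?_
  · have e : ∫ σ in Ioc 0 τ, (Iio t).indicator (fun σ => S (clamp τ (t - σ)) (g σ)) σ =
        ∫ s in (0 : ℝ)..t, S (t - s) (g s) := by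
      have eset : Ioc 0 τ ∩ Iio t = Ioo 0 t := by
        ext s
        simp only [mem_Ioo, mem_inter_iff, mem_Ioc, mem_Iio]
        exact ⟨fun h => ⟨h.1.1, h.2⟩, fun h => ⟨⟨h.1, h.2.le.trans ht.2⟩, h.2⟩⟩
      rw [setIntegral_indicator measurableSet_Iio, intervalIntegral.integral_of_le ht.1, eset,
        ← integral_Ioc_eq_integral_Ioo]
      refine setIntegral_congr_fun measurableSet_Ioc fun s hs => ?_
      simp only [clamp_of_mem (show t - s ∈ Icc 0 τ from
        ⟨by linarith [hs.2], by linarith [hs.1, ht.2]⟩)]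
    rw [← e]
    exact key.2
  · refine Eventually.of_forall fun σ => (LipschitzOnWith.of_dist_le_mul fun a _ b _ => ?_)
    rw [dist_eq_norm, Real.dist_eq, Real.coe_nnabs, abs_of_nonneg (by positivity)]
    refine (hlip _ _ _).trans (mul_le_mul_of_nonneg_left ?_ (by positivity))
    refine (abs_max_sub_max_le_abs _ _ _).trans (le_of_eq ?_)
    congr 1; ring
  · have hne : ∀ᵐ σ ∂volume.restrict (Ioc 0 τ), σ ≠ t :=
      ae_restrict_of_ae (by simp [ae_iff])
    filter_upwards [hne] with σ hσ
    rcases lt_or_gt_of_ne hσ with h | h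
    · rw [indicator_of_mem (show σ ∈ Iio t from h)]
      have h1 : HasDerivAt (fun a => ∫ r in (0 : ℝ)..(a - σ), S (clamp τ r) (g σ))
          (S (clamp τ (t - σ)) (g σ)) t :=
        ((hcx (g σ)).integral_hasStrictDerivAt 0 (t - σ)).hasDerivAt.comp_sub_const t σ
      refine h1.congr_of_eventuallyEq ?_
      filter_upwards [lt_mem_nhds h] with a ha
      rw [max_eq_left (sub_nonneg.2 ha.le)]
    · rw [indicator_of_notMem (show σ ∉ Iio t from not_lt.2 h.le)]
      refine (hasDerivAt_const t (0 : X)).congr_of_eventuallyEq ?_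
      filter_upwards [gt_mem_nhds h] with a ha
      rw [max_eq_right (sub_nonpos.2 (le_of_lt ha)), intervalIntegral.integral_same]

variable [IsScalarTower ℝ 𝕜 X]

/-- The variation of constants formula. -/
theorem Sol.mild {p : ℝ≥0∞} (hp : 1 ≤ p) (hS : IsC0Semigroup S) (hG : IsGenerator (-A) S)
    {τ : ℝ} (hτ : 0 < τ) {g u y : ℝ → X} {x : X} (h : Sol A p τ g x u y) {t : ℝ}
    (ht : t ∈ Icc 0 τ) : u t = S t x + ∫ s in (0 : ℝ)..t, S (t - s) (g s) := by
  have hg := integrableOn_of_memLp hp h.memLp_rhs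
  have hjc := hS.continuous_clamp hτ.le
  have hcx : Continuous fun r => S (clamp τ r) x :=
    hjc.comp (continuous_id.prodMk continuous_const)
  have hcu : Continuous fun r => u (clamp τ r) :=
    (h.continuousOn hp hτ.le).comp_continuous (continuous_clamp τ) (clamp_mem hτ.le)
  have e : EqOn (fun t => ∫ s in (0 : ℝ)..t, u (clamp τ s)) (fun t =>
      (∫ r in (0 : ℝ)..t, S (clamp τ r) x) +
        ∫ σ in Ioc 0 τ, ∫ r in (0 : ℝ)..max (t - σ) 0, S (clamp τ r) (g σ)) (Icc 0 τ) := by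
    intro t ht
    have e1 : ∫ s in (0 : ℝ)..t, u (clamp τ s) = ∫ s in (0 : ℝ)..t, u s := by
      refine intervalIntegral.integral_congr fun s hs => ?_
      rw [uIcc_of_le ht.1] at hs
      simp only [clamp_of_mem (show s ∈ Icc 0 τ from ⟨hs.1, hs.2.trans ht.2⟩)]
    have e2 : ∫ σ in Ioc 0 τ, ∫ r in (0 : ℝ)..max (t - σ) 0, S (clamp τ r) (g σ) =
        ∫ s in (0 : ℝ)..t, ∫ r in (0 : ℝ)..(t - s), S (clamp τ r) (g s) := by
      rw [setIntegral_eq_of_subset_of_forall_sdiff_eq_zero measurableSet_Ioc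
          (Ioc_subset_Ioc_right ht.2) fun s hs => ?_, intervalIntegral.integral_of_le ht.1]
      · refine setIntegral_congr_fun measurableSet_Ioc fun s hs => ?_
        rw [max_eq_left (sub_nonneg.2 hs.2)]
      · have : t < s := by
          by_contra hn; exact hs.2 ⟨hs.1.1, not_lt.1 hn⟩
        rw [max_eq_right (sub_nonpos.2 this.le), intervalIntegral.integral_same]
    simp only
    rw [e1, e2, h.integral_eq hp hS hG ht]
  have d1 : HasDerivWithinAt (fun t => ∫ s in (0 : ℝ)..t, u (clamp τ s)) (u (clamp τ t))
      (Icc 0 τ) t := (hcu.integral_hasStrictDerivAt 0 t).hasDerivAt.hasDerivWithinAt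
  have d2 := (((hcx.integral_hasStrictDerivAt 0 t).hasDerivAt).add
    (hS.hasDerivAt_convolution hg ht)).hasDerivWithinAt (s := Icc 0 τ)
  have d3 := (uniqueDiffOn_Icc hτ t ht).eq_deriv _ d1 (d2.congr e (e ht))
  rwa [clamp_of_mem ht] at d3

end Mild
/-! ### Convolution estimates and graph-bounded operators -/

section Young

variable {X : Type*} [NormedAddCommGroup X]

/-- Young's inequality for the convolution of `φ` with the indicator of a measurable set `E`. -/
theorem eLpNorm_le_of_enorm_le_convolution {p : ℝ≥0∞} (hp : 1 ≤ p) (hp' : p ≠ ⊤) {δ : ℝ}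
    {φ f : ℝ → X} (hφ : Continuous φ) {E : Set ℝ} (hE : MeasurableSet E)
    (hf : ∀ t ∈ Icc 0 δ, ‖f t‖ₑ ≤ ∫⁻ s in Ioc 0 t ∩ E, ‖φ (t - s)‖ₑ) :
    eLpNorm f p (timeMeasure δ) ≤ eLpNorm φ p (timeMeasure δ) * timeMeasure δ E := by
  have hp0 : p ≠ 0 := (zero_lt_one.trans_le hp).ne'
  set r := p.toReal with hr
  have hr1 : 1 ≤ r := by simpa using ENNReal.toReal_mono hp' hp
  have hr0 : 0 < r := by linarith
  set V := timeMeasure δ E with hV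
  have hVtop : V ≠ ⊤ := measure_ne_top _ _
  have hVE : V = volume (E ∩ Icc 0 δ) := Measure.restrict_apply hE
  let k : ℝ → ℝ≥0∞ := (Icc 0 δ).indicator fun a => ‖φ a‖ₑ ^ r
  have hk : Measurable k := by
    refine Measurable.indicator ?_ measurableSet_Icc
    exact (hφ.enorm.measurable).pow_const r
  have hpt : ∀ t ∈ Icc 0 δ, ‖f t‖ₑ ^ r ≤ V ^ (r - 1) * ∫⁻ s in E ∩ Icc 0 δ, k (t - s) := by
    intro t ht
    have hsub : Ioc 0 t ∩ E ⊆ E ∩ Icc 0 δ := fun s hs =>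
      ⟨hs.2, hs.1.1.le, hs.1.2.trans ht.2⟩
    have h1 : ∫⁻ s in Ioc 0 t ∩ E, ‖φ (t - s)‖ₑ ≤
        eLpNorm (fun s => φ (t - s)) p (volume.restrict (Ioc 0 t ∩ E)) * V ^ (1 - 1 / r) := by
      rw [← eLpNorm_one_eq_lintegral_enorm]
      have hc : Continuous fun s => φ (t - s) := by fun_prop
      refine (eLpNorm_le_eLpNorm_mul_rpow_measure_univ hp hc.aestronglyMeasurable).trans ?_
      rw [ENNReal.toReal_one, div_one, Measure.restrict_apply_univ, hVE]
      gcongr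
      exact sub_nonneg.2 ((div_le_one hr0).2 hr1)
    calc ‖f t‖ₑ ^ r ≤ (eLpNorm (fun s => φ (t - s)) p (volume.restrict (Ioc 0 t ∩ E)) *
          V ^ (1 - 1 / r)) ^ r := by
          gcongr
          exact (hf t ht).trans h1
      _ = (∫⁻ s in Ioc 0 t ∩ E, ‖φ (t - s)‖ₑ ^ r) * V ^ (r - 1) := by
          rw [ENNReal.mul_rpow_of_nonneg _ _ hr0.le, ← ENNReal.rpow_mul,
            eLpNorm_eq_lintegral_rpow_enorm_toReal hp0 hp', ← ENNReal.rpow_mul]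
          congr 2
          · rw [one_div, inv_mul_cancel₀ hr0.ne', ENNReal.rpow_one]
          · field_simp
      _ ≤ V ^ (r - 1) * ∫⁻ s in E ∩ Icc 0 δ, k (t - s) := by
          rw [mul_comm]
          refine mul_le_mul_right ?_ _
          refine le_trans (setLIntegral_mono' (measurableSet_Ioc.inter hE) fun s hs => ?_)
            (lintegral_mono_set hsub)
          rw [show k (t - s) = ‖φ (t - s)‖ₑ ^ r from indicator_of_mem (show t - s ∈ Icc 0 δ from
            ⟨by linarith [hs.1.2], by linarith [hs.1.1, ht.2]⟩) _]
  have hI : ∫⁻ t in Icc 0 δ, ‖f t‖ₑ ^ r ≤ V ^ r * ∫⁻ t in Icc 0 δ, ‖φ t‖ₑ ^ r := by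
    calc ∫⁻ t in Icc 0 δ, ‖f t‖ₑ ^ r
        ≤ ∫⁻ t in Icc 0 δ, V ^ (r - 1) * ∫⁻ s in E ∩ Icc 0 δ, k (t - s) :=
          setLIntegral_mono' measurableSet_Icc hpt
      _ ≤ ∫⁻ t, V ^ (r - 1) * ∫⁻ s in E ∩ Icc 0 δ, k (t - s) := setLIntegral_le_lintegral _ _
      _ = V ^ (r - 1) * ∫⁻ s in E ∩ Icc 0 δ, ∫⁻ t, k (t - s) := by
          have hm : Measurable (Function.uncurry fun t s : ℝ => k (t - s)) :=
            hk.comp (measurable_fst.sub measurable_snd)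
          have hm' : Measurable fun t : ℝ => ∫⁻ s in E ∩ Icc 0 δ, k (t - s) :=
            hm.lintegral_prod_right'
          rw [lintegral_const_mul _ hm', lintegral_lintegral_swap hm.aemeasurable]
      _ = V ^ r * ∫⁻ t in Icc 0 δ, ‖φ t‖ₑ ^ r := by
          have e1 : ∀ s, ∫⁻ t, k (t - s) = ∫⁻ t in Icc 0 δ, ‖φ t‖ₑ ^ r := fun s => by
            rw [lintegral_sub_right_eq_self k s, lintegral_indicator measurableSet_Icc]
          simp only [e1, lintegral_const, Measure.restrict_apply_univ, ← hVE]
          rw [mul_comm (∫⁻ t in Icc 0 δ, ‖φ t‖ₑ ^ r), ← mul_assoc]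
          congr 1
          nth_rw 2 [← ENNReal.rpow_one V]
          rw [← ENNReal.rpow_add_of_nonneg _ _ (by linarith) zero_le_one, sub_add_cancel]
  rw [eLpNorm_eq_lintegral_rpow_enorm_toReal hp0 hp',
      eLpNorm_eq_lintegral_rpow_enorm_toReal hp0 hp']
  refine (ENNReal.rpow_le_rpow hI (by positivity)).trans (le_of_eq ?_)
  rw [ENNReal.mul_rpow_of_nonneg _ _ (by positivity), ← ENNReal.rpow_mul, mul_one_div_cancel
    hr0.ne', ENNReal.rpow_one, mul_comm]

end Young

section GraphBounded

variable {𝕜 X : Type*} [RCLike 𝕜] [NormedAddCommGroup X] [NormedSpace 𝕜 X] {A : X →ₗ.[𝕜] X}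
  {L : A.domain →ₗ[𝕜] X}

/-- A graph-bounded operator is a continuous linear map on the graph of `A`. -/
theorem IsGraphBounded.exists_clm (hL : IsGraphBounded A L) :
    ∃ Λ : A.graph →L[𝕜] X, ∀ q : A.graph, Λ q = app L (q : X × X).1 := by
  obtain ⟨M, hM⟩ := hL
  have hmem : ∀ q : A.graph, (q : X × X).1 ∈ A.domain := fun q =>
    LinearPMap.mem_domain_of_mem_graph (y := (q : X × X).2) q.2
  let f : A.graph →ₗ[𝕜] X :=
    { toFun := fun q => app L (q : X × X).1
      map_add' := fun a b => app_add L (hmem a) (hmem b)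
      map_smul' := fun c a => by
        simp only [Submodule.coe_smul, Prod.smul_fst, RingHom.id_apply]
        rw [app_of_mem L (hmem a), app_of_mem L (A.domain.smul_mem c (hmem a)), ← map_smul]
        rfl }
  refine ⟨f.mkContinuous (|M| * 2) fun q => ?_, fun q => rfl⟩
  change ‖app L (q : X × X).1‖ ≤ _
  have hA : A ⟨_, hmem q⟩ = (q : X × X).2 := ((LinearPMap.image_iff (hmem q)).2 q.2).symm
  rw [app_of_mem L (hmem q)]
  refine (hM ⟨_, hmem q⟩).trans ?_
  rw [hA]
  have h1 : ‖(q : X × X).1‖ ≤ ‖q‖ := norm_fst_le (q : X × X)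
  have h2 : ‖(q : X × X).2‖ ≤ ‖q‖ := norm_snd_le (q : X × X)
  calc M * (‖(q : X × X).1‖ + ‖(q : X × X).2‖) ≤ |M| * (‖q‖ + ‖q‖) := by
        gcongr
        exact le_abs_self M
    _ = |M| * 2 * ‖q‖ := by ring

theorem aestronglyMeasurable_app (hL : IsGraphBounded A L) {α : Type*} [MeasurableSpace α]
    {μ : Measure α} {u y : α → X} (hu : AEStronglyMeasurable u μ) (hy : AEStronglyMeasurable y μ)
    (h : ∀ᵐ t ∂μ, (u t, y t) ∈ A.graph) : AEStronglyMeasurable (fun t => app L (u t)) μ := by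
  classical
  obtain ⟨Λ, hΛ⟩ := hL.exists_clm
  let f : α → A.graph := fun t => if ht : (u t, y t) ∈ A.graph then ⟨(u t, y t), ht⟩ else 0
  have hf : AEStronglyMeasurable (fun t => (f t : X × X)) μ := by
    refine (hu.prodMk hy).congr ?_
    filter_upwards [h] with t ht
    simp only [f, dif_pos ht]
  have hf' : AEStronglyMeasurable f μ :=
    (Topology.IsEmbedding.subtypeVal.aestronglyMeasurable_comp_iff).1 hf
  refine (Λ.continuous.comp_aestronglyMeasurable hf').congr ?_
  filter_upwards [h] with t ht
  simp only [hΛ, f, dif_pos ht]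

/-- The graph bound, in `L^p`. -/
theorem exists_eLpNorm_app_le (hL : IsGraphBounded A L) :
    ∃ M : ℝ≥0, ∀ (p : ℝ≥0∞), 1 ≤ p → ∀ (μ : Measure ℝ) (u y : ℝ → X),
      AEStronglyMeasurable u μ → AEStronglyMeasurable y μ → (∀ᵐ t ∂μ, (u t, y t) ∈ A.graph) →
      eLpNorm (fun t => app L (u t)) p μ ≤ M * (eLpNorm u p μ + eLpNorm y p μ) := by
  obtain ⟨M, hM⟩ := hL
  refine ⟨M.toNNReal, fun p hp μ u y hu hy h => ?_⟩
  have h1 : ∀ᵐ t ∂μ, ‖app L (u t)‖ ≤ M.toNNReal * ‖‖u t‖ + ‖y t‖‖ := by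
    filter_upwards [h] with t ht
    have hm := LinearPMap.mem_domain_of_mem_graph ht
    rw [app_of_mem L hm, Real.norm_of_nonneg (by positivity)]
    refine (hM ⟨_, hm⟩).trans ?_
    rw [show A ⟨_, hm⟩ = y t from ((LinearPMap.image_iff hm).2 ht).symm]
    gcongr
    exact Real.le_coe_toNNReal M
  refine (eLpNorm_le_nnreal_smul_eLpNorm_of_ae_le_mul h1 p).trans ?_
  rw [ENNReal.smul_def, smul_eq_mul]
  gcongr
  refine (eLpNorm_add_le hu.norm hy.norm hp).trans ?_
  rw [eLpNorm_norm, eLpNorm_norm]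

theorem Sol.memLp_app [NormedSpace ℝ X] [CompleteSpace X] (hL : IsGraphBounded A L) {p : ℝ≥0∞}
    (hp : 1 ≤ p) {τ : ℝ} (hτ : 0 ≤ τ) {g u y : ℝ → X} {x : X} (h : Sol A p τ g x u y) :
    MemLp (fun t => app L (u t)) p (timeMeasure τ) := by
  obtain ⟨M, hM⟩ := exists_eLpNorm_app_le hL
  have hu : MemLp u p (timeMeasure τ) := memLp_of_continuousOn (h.continuousOn hp hτ)
  refine ⟨aestronglyMeasurable_app hL hu.aestronglyMeasurable h.memLp_img.aestronglyMeasurable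
    h.graph, (hM p hp _ u y hu.aestronglyMeasurable h.memLp_img.aestronglyMeasurable
    h.graph).trans_lt ?_⟩
  exact ENNReal.mul_lt_top ENNReal.coe_lt_top
    (ENNReal.add_lt_top.2 ⟨hu.eLpNorm_lt_top, h.memLp_img.eLpNorm_lt_top⟩)

end GraphBounded
/-! ### The admissibility estimate for solutions -/

section Dense

variable {𝕜 X : Type*} [RCLike 𝕜] [NormedAddCommGroup X] [NormedSpace 𝕜 X] {p : ℝ≥0∞} {δ : ℝ}

/-- Simple functions with values in a dense subspace are dense in `L^p`. -/
theorem exists_simpleFunc_dense {D : Submodule 𝕜 X} (hD : Dense (D : Set X)) (hp : 1 ≤ p)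
    (hp' : p ≠ ⊤) {g : ℝ → X} (hg : MemLp g p (timeMeasure δ)) {ε : ℝ≥0∞} (hε : ε ≠ 0) :
    ∃ f : SimpleFunc ℝ D, eLpNorm (fun s => g s - f s) p (timeMeasure δ) ≤ ε := by
  have hε2 : ε / 2 ≠ 0 := (ENNReal.half_pos hε).ne'
  obtain ⟨k, hk, hkm⟩ := hg.exists_simpleFunc_eLpNorm_sub_lt hp' hε2
  obtain ⟨η, hη0, hη⟩ := ENNReal.exists_nnreal_pos_mul_lt
    (a := timeMeasure δ univ ^ p.toReal⁻¹) (b := ε / 2)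
    (ENNReal.rpow_ne_top_of_nonneg (by positivity) (measure_ne_top _ _)) hε2
  have hψ : ∀ x : X, ∃ d : D, dist x d < η := fun x => by
    obtain ⟨d, hd, h⟩ := hD.exists_dist_lt x (show (0 : ℝ) < η from hη0)
    exact ⟨⟨d, hd⟩, h⟩
  choose ψ hψ using hψ
  refine ⟨k.map ψ, ?_⟩
  have h1 : eLpNorm (fun s => k s - (ψ (k s) : X)) p (timeMeasure δ) ≤ ε / 2 := by
    refine (eLpNorm_le_of_ae_enorm_bound (C := η) (Eventually.of_forall fun s => ?_)).trans hη.le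
    rw [← edist_eq_enorm_sub, edist_nndist, ENNReal.coe_le_coe]
    exact (hψ (k s)).le
  have e : (fun s => g s - (k.map ψ s : X)) = (g - ⇑k) + fun s => k s - (ψ (k s) : X) := by
    ext s; simp
  rw [e]
  refine (eLpNorm_add_le (hg.sub hkm).aestronglyMeasurable ?_ hp).trans
    ((add_le_add hk.le h1).trans (le_of_eq (ENNReal.add_halves ε)))
  exact (k.map fun x => x - (ψ x : X)).aestronglyMeasurable

end Dense

section Estimate

variable {𝕜 X : Type*} [RCLike 𝕜] [NormedAddCommGroup X] [NormedSpace 𝕜 X] {A : X →ₗ.[𝕜] X}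
  {L : A.domain →ₗ[𝕜] X} {S : ℝ → X →L[𝕜] X} [NormedSpace ℝ X] [IsScalarTower ℝ 𝕜 X]
  [CompleteSpace X] {p : ℝ≥0∞} {τ₀ δ : ℝ} {Γ : ℝ≥0}

/-- The admissibility estimate for the right-hand side `1_E x` with `x` in the domain: there `L u`
is the convolution of `L S x` with `1_E`. -/
theorem Sol.eLpNorm_app_indicator_le (hp : 1 ≤ p) (hp' : p ≠ ⊤) (hA : A.IsClosed)
    (hS : IsC0Semigroup S) (hG : IsGenerator (-A) S) (hL : IsGraphBounded A L) (hδ : 0 < δ)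
    (hadm : ∀ x ∈ A.domain, eLpNorm (fun t => app L (S t x)) p (timeMeasure δ) ≤ Γ * ‖x‖ₑ)
    {x : X} (hx : x ∈ A.domain) {E : Set ℝ} (hE : MeasurableSet E) {u y : ℝ → X}
    (h : Sol A p δ (E.indicator fun _ => x) 0 u y) :
    eLpNorm (fun t => app L (u t)) p (timeMeasure δ) ≤ Γ * ‖x‖ₑ * timeMeasure δ E := by
  obtain ⟨Λ, hΛ⟩ := hL.exists_clm
  have hcl : IsClosed (A.graph : Set (X × X)) := hA
  have : CompleteSpace A.graph := hcl.completeSpace_coe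
  have hjc := hS.continuous_clamp hδ.le
  have hcx : ∀ z, Continuous fun r => S (clamp δ r) z := fun z =>
    hjc.comp (continuous_id.prodMk continuous_const)
  let q : ℝ → A.graph := fun r => ⟨(S (clamp δ r) x, S (clamp δ r) (app A.toFun x)),
    hG.mem_graph hS (mem_graph_app hx) (clamp_mem hδ.le r).1⟩
  have hq : Continuous q := ((hcx _).prodMk (hcx _)).subtype_mk _
  have hφ : Continuous fun r => Λ (q r) := Λ.continuous.comp hq
  have hφe : eLpNorm (fun r => Λ (q r)) p (timeMeasure δ) ≤ Γ * ‖x‖ₑ := by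
    refine le_trans (le_of_eq (eLpNorm_congr_ae ?_)) (hadm x hx)
    filter_upwards [ae_restrict_mem measurableSet_Icc] with t ht
    rw [hΛ]
    simp only [q, clamp_of_mem ht]
  refine (eLpNorm_le_of_enorm_le_convolution hp hp' hφ hE fun t ht => ?_).trans
    (mul_le_mul_left hφe _)
  have hqt : Continuous fun s => q (t - s) := by fun_prop
  have hqi : IntegrableOn (fun s => q (t - s)) (Ioc 0 t ∩ E) :=
    (hqt.continuousOn.integrableOn_Icc (a := 0) (b := t)).mono_set
      (inter_subset_left.trans Ioc_subset_Icc_self)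
  have hu : u t = ((∫ s in Ioc 0 t ∩ E, q (t - s) : A.graph) : X × X).1 := by
    have e1 := ((ContinuousLinearMap.fst 𝕜 X X).comp A.graph.subtypeL).integral_comp_comm hqi
    refine Eq.trans ?_ e1
    rw [h.mild hp hS hG hδ ht, map_zero, zero_add, intervalIntegral.integral_of_le ht.1,
      ← setIntegral_indicator hE]
    refine setIntegral_congr_fun measurableSet_Ioc fun s hs => ?_
    have hm : clamp δ (t - s) = t - s := clamp_of_mem ⟨by linarith [hs.2], by linarith [hs.1, ht.2]⟩
    by_cases hsE : s ∈ E
    · simp [hsE, q, hm]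
    · simp [hsE]
  rw [hu, ← hΛ, ← Λ.integral_comp_comm hqi]
  exact enorm_integral_le_lintegral_enorm _

/-- The admissibility estimate for simple right-hand sides with values in the domain. -/
theorem Sol.eLpNorm_app_simpleFunc_le (hp : 1 ≤ p) (hp' : p ≠ ⊤) (hA : A.IsClosed)
    (hτ₀ : 0 < τ₀) (hreg : HasMaximalRegularity A p τ₀)
    (hS : IsC0Semigroup S) (hG : IsGenerator (-A) S) (hL : IsGraphBounded A L) (hδ : 0 < δ)
    (hδτ : δ ≤ τ₀)
    (hadm : ∀ x ∈ A.domain, eLpNorm (fun t => app L (S t x)) p (timeMeasure δ) ≤ Γ * ‖x‖ₑ)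
    (f : SimpleFunc ℝ A.domain) {u y : ℝ → X} (h : Sol A p δ (fun s => (f s : X)) 0 u y) :
    eLpNorm (fun t => app L (u t)) p (timeMeasure δ) ≤ Γ * ∫⁻ s, ‖f s‖ₑ ∂timeMeasure δ := by
  induction f using SimpleFunc.induction generalizing u y with
  | const c hs =>
    rename_i s
    have e : (fun t => ((SimpleFunc.piecewise s hs (SimpleFunc.const ℝ c)
        (SimpleFunc.const ℝ 0) t : A.domain) : X)) = s.indicator fun _ => (c : X) := by
      ext t
      by_cases ht : t ∈ s <;> simp [ht]
    rw [e] at h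
    refine (h.eLpNorm_app_indicator_le hp hp' hA hS hG hL hδ hadm c.2 hs).trans (le_of_eq ?_)
    have e2 : (fun t => ‖SimpleFunc.piecewise s hs (SimpleFunc.const ℝ c)
        (SimpleFunc.const ℝ 0) t‖ₑ) = s.indicator fun _ => ‖(c : X)‖ₑ := by
      ext t
      by_cases ht : t ∈ s
      · simp [ht]
        rfl
      · simp [ht]
    rw [e2, lintegral_indicator hs, setLIntegral_const, mul_assoc]
  | @add f g hfg hf hg =>
    have hmem : ∀ k : SimpleFunc ℝ A.domain, MemLp (fun s => (k s : X)) p (timeMeasure δ) :=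
      fun k => (k.map (Subtype.val : A.domain → X)).memLp_of_isFiniteMeasure p _
    obtain ⟨uf, yf, h1⟩ := exists_sol_zero hp hτ₀ hreg hδτ (hmem f)
    obtain ⟨ug, yg, h2⟩ := exists_sol_zero hp hτ₀ hreg hδτ (hmem g)
    have h3 := h1.add hp h2
    rw [add_zero] at h3
    have heq := h.unique hp hτ₀ hreg hδ.le hδτ h3
    have hae : (fun t => app L (u t)) =ᵐ[timeMeasure δ]
        (fun t => app L (uf t)) + fun t => app L (ug t) := by
      filter_upwards [h1.graph, h2.graph, ae_restrict_mem measurableSet_Icc] with t ht1 ht2 hm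
      rw [Pi.add_apply, heq hm, app_add L (LinearPMap.mem_domain_of_mem_graph ht1)
        (LinearPMap.mem_domain_of_mem_graph ht2)]
    rw [eLpNorm_congr_ae hae]
    refine (eLpNorm_add_le (h1.memLp_app hL hp hδ.le).aestronglyMeasurable
      (h2.memLp_app hL hp hδ.le).aestronglyMeasurable hp).trans ?_
    refine (add_le_add (hf h1) (hg h2)).trans (le_of_eq ?_)
    rw [← mul_add, ← lintegral_add_left (by fun_prop)]
    congr 2
    ext t
    by_cases ht : f t = 0
    · simp [ht]
    · have : g t = 0 := by
        by_contra hgt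
        exact disjoint_left.1 hfg (show t ∈ Function.support f from ht) hgt
      simp [this]

/-- A crude bound for `L u`, by maximal regularity and the graph bound. -/
theorem exists_app_bound (hp : 1 ≤ p) (hA : A.IsClosed)
    (hτ₀ : 0 < τ₀) (hreg : HasMaximalRegularity A p τ₀) (hL : IsGraphBounded A L) (hδ : 0 ≤ δ)
    (hδτ : δ ≤ τ₀) :
    ∃ B : ℝ≥0∞, B ≠ ⊤ ∧ ∀ g u y : ℝ → X, Sol A p δ g 0 u y →
      eLpNorm (fun t => app L (u t)) p (timeMeasure δ) ≤ B * eLpNorm g p (timeMeasure δ) := by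
  obtain ⟨K, hK⟩ := exists_img_bound hp hτ₀ hA hreg
  obtain ⟨M, hM⟩ := exists_eLpNorm_app_le hL
  set e : ℝ := 1 - 1 / p.toReal
  have he : 0 ≤ e := one_sub_one_div_toReal_nonneg hp
  set a : ℝ≥0∞ := ENNReal.ofReal δ ^ e
  set b : ℝ≥0∞ := timeMeasure δ univ ^ p.toReal⁻¹
  have ha : a ≠ ⊤ := ENNReal.rpow_ne_top_of_nonneg he ENNReal.ofReal_ne_top
  have hb : b ≠ ⊤ := ENNReal.rpow_ne_top_of_nonneg (by positivity) (measure_ne_top _ _)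
  refine ⟨M * ((1 + K) * a * b + K), by finiteness, fun g u y h => ?_⟩
  have hy := hK δ hδ hδτ g u y h
  set G := eLpNorm g p (timeMeasure δ)
  have hu : eLpNorm u p (timeMeasure δ) ≤ (1 + K) * a * b * G := by
    have h1 : ∀ᵐ t ∂timeMeasure δ, ‖u t‖ₑ ≤ (1 + K) * G * a := by
      filter_upwards [ae_restrict_mem measurableSet_Icc] with t ht
      have h' := h.mono ht.2
      rw [h.eq t ht, zero_add]
      refine (enorm_integral_le hp ht.1
        (h'.memLp_rhs.sub h'.memLp_img).aestronglyMeasurable).trans ?_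
      refine mul_le_mul' ?_ (ENNReal.rpow_le_rpow (ENNReal.ofReal_le_ofReal ht.2) he)
      refine (eLpNorm_mono_measure _ (timeMeasure_mono ht.2)).trans ?_
      refine (eLpNorm_sub_le h.memLp_rhs.aestronglyMeasurable
        h.memLp_img.aestronglyMeasurable hp).trans ?_
      rw [add_mul, one_mul]
      exact add_le_add_right hy _
    refine (eLpNorm_le_of_ae_enorm_bound h1).trans (le_of_eq ?_)
    rw [smul_eq_mul]
    ring
  refine (hM p hp _ u y ((memLp_of_continuousOn (p := p)
    (h.continuousOn hp hδ)).aestronglyMeasurable) h.memLp_img.aestronglyMeasurable h.graph).trans ?_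
  rw [mul_assoc, add_mul]
  gcongr

/-- An admissible operator `L` satisfies `‖L u‖ ≤ Γ δ^{1 - 1/p} ‖g‖` in `L^p(0, δ)`, where `u` is
the solution with right-hand side `g` and initial value `0`. The exponent of `δ` is positive, so
the bound is small for short times. -/
theorem Sol.eLpNorm_app_le (hp : 1 ≤ p) (hp' : p ≠ ⊤) (hA : A.IsClosed)
    (hd : Dense (A.domain : Set X)) (hτ₀ : 0 < τ₀) (hreg : HasMaximalRegularity A p τ₀)
    (hS : IsC0Semigroup S) (hG : IsGenerator (-A) S) (hL : IsGraphBounded A L) (hδ : 0 < δ)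
    (hδτ : δ ≤ τ₀)
    (hadm : ∀ x ∈ A.domain, eLpNorm (fun t => app L (S t x)) p (timeMeasure δ) ≤ Γ * ‖x‖ₑ)
    {g u y : ℝ → X} (h : Sol A p δ g 0 u y) :
    eLpNorm (fun t => app L (u t)) p (timeMeasure δ) ≤
      Γ * ENNReal.ofReal δ ^ (1 - 1 / p.toReal) * eLpNorm g p (timeMeasure δ) := by
  obtain ⟨B, hB, hbd⟩ := exists_app_bound hp hA hτ₀ hreg hL hδ.le hδτ
  set c : ℝ≥0∞ := Γ * ENNReal.ofReal δ ^ (1 - 1 / p.toReal) with hc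
  have hctop : c ≠ ⊤ := by
    refine ENNReal.mul_ne_top ENNReal.coe_ne_top (ENNReal.rpow_ne_top_of_ne_zero ?_
      ENNReal.ofReal_ne_top)
    simpa using hδ
  refine ENNReal.le_of_forall_pos_le_add fun ε hε _ => ?_
  obtain ⟨η, hη0, hη⟩ := ENNReal.exists_nnreal_pos_mul_lt (a := c + B) (b := ε) (by finiteness)
    (by exact_mod_cast hε.ne')
  obtain ⟨f, hf⟩ := exists_simpleFunc_dense hd hp hp' h.memLp_rhs
    (ε := η) (by exact_mod_cast hη0.ne')
  have hfm : MemLp (fun s => (f s : X)) p (timeMeasure δ) :=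
    (f.map (Subtype.val : A.domain → X)).memLp_of_isFiniteMeasure p _
  obtain ⟨uf, yf, h1⟩ := exists_sol_zero hp hτ₀ hreg hδτ hfm
  have h2 := h.sub hp h1
  rw [sub_zero] at h2
  have hae : (fun t => app L (u t)) =ᵐ[timeMeasure δ]
      (fun t => app L (uf t)) + fun t => app L (u t - uf t) := by
    filter_upwards [h.graph, h1.graph] with t ht1 ht2
    rw [Pi.add_apply, app_sub L (LinearPMap.mem_domain_of_mem_graph ht1)
      (LinearPMap.mem_domain_of_mem_graph ht2), add_sub_cancel]
  have h3 : eLpNorm (fun t => app L (uf t)) p (timeMeasure δ) ≤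
      c * eLpNorm (fun s => (f s : X)) p (timeMeasure δ) := by
    refine (h1.eLpNorm_app_simpleFunc_le hp hp' hA hτ₀ hreg hS hG hL hδ hδτ hadm f).trans ?_
    have := eLpNorm_one_le hp hfm.aestronglyMeasurable
    rw [eLpNorm_one_eq_lintegral_enorm] at this
    rw [hc, mul_assoc, mul_comm (ENNReal.ofReal δ ^ _)]
    exact mul_le_mul_right this _
  have h4 : eLpNorm (fun s => (f s : X)) p (timeMeasure δ) ≤ eLpNorm g p (timeMeasure δ) + η := by
    have e : (fun s => (f s : X)) = g - fun s => g s - (f s : X) := by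
      ext s; simp
    rw [e]
    refine (eLpNorm_sub_le h.memLp_rhs.aestronglyMeasurable
      (h.memLp_rhs.sub hfm).aestronglyMeasurable hp).trans ?_
    exact add_le_add_right hf _
  rw [eLpNorm_congr_ae hae]
  calc eLpNorm ((fun t => app L (uf t)) + fun t => app L (u t - uf t)) p (timeMeasure δ)
      ≤ eLpNorm (fun t => app L (uf t)) p (timeMeasure δ) +
        eLpNorm (fun t => app L (u t - uf t)) p (timeMeasure δ) :=
        eLpNorm_add_le (h1.memLp_app hL hp hδ.le).aestronglyMeasurable
          (h2.memLp_app hL hp hδ.le).aestronglyMeasurable hp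
    _ ≤ c * (eLpNorm g p (timeMeasure δ) + η) + B * η :=
        add_le_add (h3.trans (by gcongr)) ((hbd _ _ _ h2).trans (by gcongr))
    _ = c * eLpNorm g p (timeMeasure δ) + η * (c + B) := by ring
    _ ≤ c * eLpNorm g p (timeMeasure δ) + ε := by gcongr

end Estimate
/-! ### The nonlinear problem -/

theorem memLp_lipschitz_comp {X : Type*} [NormedAddCommGroup X]
    {p : ℝ≥0∞} {F : X → X} {κ τ : ℝ} (hF : ∀ x y : X, ‖F x - F y‖ ≤ κ * ‖x - y‖)
    {f : ℝ → X} (hf : MemLp f p (timeMeasure τ)) : MemLp (fun t => F (f t)) p (timeMeasure τ) := by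
  have hFc : Continuous F := (LipschitzWith.of_dist_le' (K := κ) fun x y => by
    rw [dist_eq_norm, dist_eq_norm]; exact hF x y).continuous
  have h1 : MemLp (fun t => F (f t) - F 0) p (timeMeasure τ) :=
    MemLp.of_le_mul (c := κ) hf
      ((hFc.comp_aestronglyMeasurable hf.aestronglyMeasurable).sub aestronglyMeasurable_const)
      (Eventually.of_forall fun t => by simpa using hF (f t) 0)
  refine (h1.add (memLp_const (F 0))).ae_eq (Eventually.of_forall fun t => ?_)
  simp

section Nonlinear

variable {𝕜 X : Type*} [RCLike 𝕜] [NormedAddCommGroup X] [NormedSpace 𝕜 X] [NormedSpace ℝ X]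

/-- On time intervals of length at most `δ`, the map from a right-hand side `g` to `N(u)`, where `u`
is the solution with right-hand side `g` and a given initial value, is a contraction of `L^p` with
constant `q`. -/
structure ContractsUpTo (A : X →ₗ.[𝕜] X) (p : ℝ≥0∞) (δ : ℝ) (q : ℝ≥0) (N : X → X) : Prop where
  memLp : ∀ b, 0 < b → b ≤ δ → ∀ (g : ℝ → X) (x : X) (u y : ℝ → X), Sol A p b g x u y →
    MemLp (fun t => N (u t)) p (timeMeasure b)
  lip : ∀ b, 0 < b → b ≤ δ → ∀ (g g' : ℝ → X) (x : X) (u u' y y' : ℝ → X),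
    Sol A p b g x u y → Sol A p b g' x u' y' →
    eLpNorm (fun t => N (u t) - N (u' t)) p (timeMeasure b) ≤
      q * eLpNorm (fun t => g t - g' t) p (timeMeasure b)

variable {A : X →ₗ.[𝕜] X} [CompleteSpace X] {p : ℝ≥0∞} {τ₀ δ : ℝ} {q : ℝ≥0}
  {N : X → X}

/-- Local existence, from Banach's fixed point theorem in `L^p`. The initial value `x` is required
to be that of some solution of the linear problem. -/
theorem ContractsUpTo.exists_sol (hN : ContractsUpTo A p δ q N) (hq : q < 1) (hp : 1 ≤ p)
    (hτ₀ : 0 < τ₀) (hreg : HasMaximalRegularity A p τ₀) (hδ : 0 < δ) (hδτ : δ ≤ τ₀) {x : X}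
    {g₀ u₀ y₀ : ℝ → X} (h₀ : Sol A p δ g₀ x u₀ y₀) :
    ∃ u y, Sol A p δ (fun t => N (u t)) x u y := by
  have : Fact (1 ≤ p) := ⟨hp⟩
  have hex : ∀ f : Lp X p (timeMeasure δ), ∃ r : (ℝ → X) × (ℝ → X), Sol A p δ f x r.1 r.2 := by
    intro f
    obtain ⟨w, z, h⟩ := exists_sol_zero hp hτ₀ hreg hδτ ((Lp.memLp f).sub h₀.memLp_rhs)
    have h1 := h.add hp h₀
    rw [zero_add] at h1
    exact ⟨(_, _), h1.congr_rhs (Eventually.of_forall fun t => by simp)⟩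
  choose r hr using hex
  have hm := fun f => hN.memLp δ hδ le_rfl _ _ _ _ (hr f)
  let Φ : Lp X p (timeMeasure δ) → Lp X p (timeMeasure δ) := fun f => (hm f).toLp _
  have hΦ : ContractingWith q Φ := by
    refine ⟨hq, fun f f' => ?_⟩
    rw [Lp.edist_toLp_toLp, Lp.edist_def]
    exact hN.lip δ hδ le_rfl _ _ _ _ _ _ _ (hr f) (hr f')
  have hfix : Φ hΦ.fixedPoint = hΦ.fixedPoint := hΦ.fixedPoint_isFixedPt
  have hae := (hm hΦ.fixedPoint).coeFn_toLp
  exact ⟨_, _, (hr hΦ.fixedPoint).congr_rhs (by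
    have : ((hm hΦ.fixedPoint).toLp _ : Lp X p (timeMeasure δ)) = hΦ.fixedPoint := hfix
    rwa [this] at hae)⟩

/-- Solutions of the nonlinear problem exist on intervals of any length. A solution on `[0, b]` is
restarted at a time shortly before `b` at which its value lies in the domain of `A`. -/
theorem ContractsUpTo.exists_sol_long (hN : ContractsUpTo A p δ q N) (hq : q < 1) (hp : 1 ≤ p)
    (hτ₀ : 0 < τ₀) (hreg : HasMaximalRegularity A p τ₀) (hδ : 0 < δ) (hδτ : δ ≤ τ₀) {x : X}
    {g₀ u₀ y₀ : ℝ → X} (h₀ : Sol A p δ g₀ x u₀ y₀) (τ : ℝ) :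
    ∃ u y, Sol A p τ (fun t => N (u t)) x u y := by
  have key : ∀ n : ℕ, ∃ u y, Sol A p (δ + n * (δ / 2)) (fun t => N (u t)) x u y := by
    intro n
    induction n with
    | zero => simpa using hN.exists_sol hq hp hτ₀ hreg hδ hδτ h₀
    | succ n ih =>
      obtain ⟨u, y, h⟩ := ih
      set b := δ + n * (δ / 2) with hb
      have hbδ : δ ≤ b := by rw [hb]; linarith [show 0 ≤ n * (δ / 2) by positivity]
      obtain ⟨a, ha, haG⟩ : ∃ a ∈ Ioo (b - δ / 2) b, (u a, y a) ∈ A.graph := by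
        have hne : (ae (volume.restrict (Ioo (b - δ / 2) b))).NeBot := by
          rw [ae_neBot, Ne, Measure.restrict_eq_zero, Real.volume_Ioo]
          simpa using hδ
        have h1 : ∀ᵐ t ∂volume.restrict (Ioo (b - δ / 2) b), (u t, y t) ∈ A.graph :=

          ae_mono (Measure.restrict_mono (show Ioo (b - δ / 2) b ⊆ Icc 0 b from
            fun t ht => ⟨by linarith [ht.1], ht.2.le⟩) le_rfl) h.graph
        obtain ⟨a, ha⟩ := ((ae_restrict_mem measurableSet_Ioo).and h1).exists
        exact ⟨a, ha.1, ha.2⟩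
      obtain ⟨w, z, hw⟩ := hN.exists_sol hq hp hτ₀ hreg hδ hδτ (Sol.const haG)
      have hglue := (h.mono ha.2.le).glue hp (by linarith [ha.1]) hw
      have e : glue a (fun t => N (u t)) (fun t => N (w t)) = fun t => N (glue a u w t) := by
        ext t
        by_cases ht : t ≤ a
        · simp only [glue_of_le ht]
        · simp only [glue_of_lt (not_le.1 ht)]
      rw [e] at hglue
      exact ⟨_, _, hglue.mono (by push_cast; linarith [ha.1])⟩
  obtain ⟨n, hn⟩ := exists_nat_ge (τ / (δ / 2))
  obtain ⟨u, y, h⟩ := key n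
  exact ⟨u, y, h.mono (by linarith [(div_le_iff₀ (half_pos hδ)).1 hn])⟩

variable [IsScalarTower ℝ 𝕜 X]

theorem ContractsUpTo.unique_short (hN : ContractsUpTo A p δ q N) (hq : q < 1) (hp : 1 ≤ p)
    (hτ₀ : 0 < τ₀) (hreg : HasMaximalRegularity A p τ₀) (hδτ : δ ≤ τ₀) {b : ℝ} (hb : 0 < b)
    (hbδ : b ≤ δ) {x : X} {u u' y y' : ℝ → X} (h : Sol A p b (fun t => N (u t)) x u y)
    (h' : Sol A p b (fun t => N (u' t)) x u' y') : EqOn u u' (Icc 0 b) := by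
  have hl := hN.lip b hb hbδ _ _ _ _ _ _ _ h h'
  have hm : MemLp (fun t => N (u t) - N (u' t)) p (timeMeasure b) := h.memLp_rhs.sub h'.memLp_rhs
  have h0 : eLpNorm (fun t => N (u t) - N (u' t)) p (timeMeasure b) = 0 := by
    by_contra hne
    have : (q : ℝ≥0∞) * eLpNorm (fun t => N (u t) - N (u' t)) p (timeMeasure b) <
        1 * eLpNorm (fun t => N (u t) - N (u' t)) p (timeMeasure b) :=
      ENNReal.mul_lt_mul_left hne hm.eLpNorm_ne_top (by exact_mod_cast hq)
    rw [one_mul] at this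
    exact absurd hl (not_le.2 this)
  rw [eLpNorm_eq_zero_iff hm.aestronglyMeasurable (zero_lt_one.trans_le hp).ne'] at h0
  refine h.unique hp hτ₀ hreg hb.le (hbδ.trans hδτ) (h'.congr_rhs ?_)
  filter_upwards [h0] with t ht
  exact (sub_eq_zero.1 ht).symm

/-- Solutions of the nonlinear problem are unique on intervals of any length. -/
theorem ContractsUpTo.unique (hN : ContractsUpTo A p δ q N) (hq : q < 1) (hp : 1 ≤ p)
    (hτ₀ : 0 < τ₀) (hreg : HasMaximalRegularity A p τ₀) (hδ : 0 < δ) (hδτ : δ ≤ τ₀) {τ : ℝ}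
    {x : X} {u u' y y' : ℝ → X} (h : Sol A p τ (fun t => N (u t)) x u y)
    (h' : Sol A p τ (fun t => N (u' t)) x u' y') : EqOn u u' (Icc 0 τ) := by
  have key : ∀ n : ℕ, ∀ t ∈ Icc 0 τ, t ≤ n * δ → u t = u' t := by
    intro n
    induction n with
    | zero =>
      intro t ht ht'
      have : t = 0 := le_antisymm (by simpa using ht') ht.1
      rw [this, h.initial (ht.1.trans ht.2), h'.initial (ht.1.trans ht.2)]
    | succ n ih =>
      intro t ht ht'
      rcases le_or_gt t (n * δ) with hle | hlt
      · exact ih t ht hle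
      have ha : 0 ≤ n * δ := by positivity
      have e : n * δ + (τ - n * δ) = τ := add_sub_cancel _ _
      have s := Sol.shift hp ha (e.symm ▸ h)
      have s' := Sol.shift hp ha (e.symm ▸ h')
      rw [← ih (n * δ) ⟨ha, hlt.le.trans ht.2⟩ le_rfl] at s'
      have hb : 0 < min δ (τ - n * δ) := lt_min hδ (by linarith [ht.2])
      have := hN.unique_short hq hp hτ₀ hreg hδτ hb (min_le_left _ _)
        (s.mono (min_le_right _ _)) (s'.mono (min_le_right _ _))
        (show t - n * δ ∈ Icc 0 _ from ⟨by linarith, le_min (by push_cast at ht'; linarith)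
          (by linarith [ht.2])⟩)
      simpa using this
  intro t ht
  obtain ⟨n, hn⟩ := exists_nat_ge (t / δ)
  exact key n t ht ((div_le_iff₀ hδ).1 hn)

/-- The nonlinearity `P u + F(C u)` contracts on short time intervals: the admissibility estimates
for `P` and `C` carry the factor `δ^{1 - 1/p}`, which tends to `0` with `δ`. -/
theorem exists_contractsUpTo {S : ℝ → X →L[𝕜] X} (hp : 1 < p) (hp' : p ≠ ⊤) (hA : A.IsClosed)
    (hd : Dense (A.domain : Set X)) (hτ₀ : 0 < τ₀) (hreg : HasMaximalRegularity A p τ₀)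
    (hS : IsC0Semigroup S) (hG : IsGenerator (-A) S) {P C : A.domain →ₗ[𝕜] X}
    (hP : IsGraphBounded A P) (hC : IsGraphBounded A C) {α : ℝ} (hα : 0 < α) {Γ : ℝ≥0}
    (hadmP : ∀ x ∈ A.domain, eLpNorm (fun t => app P (S t x)) p (timeMeasure α) ≤ Γ * ‖x‖ₑ)
    (hadmC : ∀ x ∈ A.domain, eLpNorm (fun t => app C (S t x)) p (timeMeasure α) ≤ Γ * ‖x‖ₑ)
    {F : X → X} {κ : ℝ≥0} (hF : ∀ x y : X, ‖F x - F y‖ ≤ κ * ‖x - y‖) {τ₁ : ℝ} (hτ₁ : 0 < τ₁) :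
    ∃ δ, 0 < δ ∧ δ ≤ τ₀ ∧ δ ≤ τ₁ ∧
      ContractsUpTo A p δ (1 / 2) (fun z => app P z + F (app C z)) := by
  have hp1 := hp.le
  set e : ℝ := 1 - 1 / p.toReal with he_def
  have he : 0 < e := by
    have h1 : 1 < p.toReal := by simpa using (ENNReal.toReal_lt_toReal (by simp) hp').2 hp
    rw [he_def, sub_pos, div_lt_one (by linarith)]
    exact h1
  have hlim : Tendsto (fun δ : ℝ => (1 + κ : ℝ≥0∞) * Γ * ENNReal.ofReal δ ^ e) (𝓝[>] 0) (𝓝 0) := by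
    have h1 : Tendsto (fun δ : ℝ => ENNReal.ofReal δ ^ e) (𝓝[>] 0) (𝓝 0) := by
      have h2 : Continuous fun δ : ℝ => ENNReal.ofReal δ ^ e :=
        (ENNReal.continuous_rpow_const).comp ENNReal.continuous_ofReal
      have h3 := h2.tendsto 0
      simp only [ENNReal.ofReal_zero, ENNReal.zero_rpow_of_pos he] at h3
      exact h3.mono_left nhdsWithin_le_nhds
    simpa using ENNReal.Tendsto.const_mul h1 (Or.inr (by finiteness))
  have hev := hlim.eventually_le_const (show (0 : ℝ≥0∞) < ((1 / 2 : ℝ≥0) : ℝ≥0∞) by simp)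
  obtain ⟨δ, hδ, hδ0, hδm⟩ := (hev.and (Ioc_mem_nhdsGT
    (show (0 : ℝ) < min (min τ₀ τ₁) α by positivity))).exists
  have hδτ₀ : δ ≤ τ₀ := hδm.trans ((min_le_left _ _).trans (min_le_left _ _))
  have hδα : δ ≤ α := hδm.trans (min_le_right _ _)
  refine ⟨δ, hδ0, hδτ₀, hδm.trans ((min_le_left _ _).trans (min_le_right _ _)), ?_, ?_⟩
  · intro b hb _ g x u y h
    exact (h.memLp_app hP hp1 hb.le).add (memLp_lipschitz_comp hF (h.memLp_app hC hp1 hb.le))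
  · intro b hb hbδ g g' x u u' y y' h h'
    have hs := h.sub hp1 h'
    rw [sub_self] at hs
    have hest : ∀ {L : A.domain →ₗ[𝕜] X}, IsGraphBounded A L →
        (∀ x ∈ A.domain, eLpNorm (fun t => app L (S t x)) p (timeMeasure α) ≤ Γ * ‖x‖ₑ) →
        eLpNorm (fun t => app L (u t - u' t)) p (timeMeasure b) ≤
          Γ * ENNReal.ofReal δ ^ e * eLpNorm (fun t => g t - g' t) p (timeMeasure b) := by
      intro L hL hadm
      refine (hs.eLpNorm_app_le hp1 hp' hA hd hτ₀ hreg hS hG hL hb (hbδ.trans hδτ₀)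
        fun x hx => (eLpNorm_mono_measure _ (timeMeasure_mono (hbδ.trans hδα))).trans
        (hadm x hx)).trans ?_
      gcongr
    have hae : ∀ᵐ t ∂timeMeasure b, ‖app P (u t) + F (app C (u t)) -
        (app P (u' t) + F (app C (u' t)))‖ ≤
        ‖‖app P (u t - u' t)‖ + κ * ‖app C (u t - u' t)‖‖ := by
      filter_upwards [h.graph, h'.graph] with t ht ht'
      have hm := LinearPMap.mem_domain_of_mem_graph ht
      have hm' := LinearPMap.mem_domain_of_mem_graph ht'
      rw [app_sub P hm hm', app_sub C hm hm', Real.norm_of_nonneg (by positivity),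
        add_sub_add_comm]
      exact (norm_add_le _ _).trans (add_le_add_right (hF _ _) _)
    have mP := (hs.memLp_app hP hp1 hb.le).aestronglyMeasurable
    have mC := (hs.memLp_app hC hp1 hb.le).aestronglyMeasurable
    set G := eLpNorm (fun t => g t - g' t) p (timeMeasure b)
    calc _ ≤ eLpNorm (fun t => ‖app P (u t - u' t)‖ + κ * ‖app C (u t - u' t)‖) p
          (timeMeasure b) := eLpNorm_mono_ae hae
      _ ≤ eLpNorm (fun t => ‖app P (u t - u' t)‖) p (timeMeasure b) +
          eLpNorm (fun t => (κ : ℝ) * ‖app C (u t - u' t)‖) p (timeMeasure b) :=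
          eLpNorm_add_le mP.norm (mC.norm.const_mul _) hp1
      _ = eLpNorm (fun t => app P (u t - u' t)) p (timeMeasure b) +
          κ * eLpNorm (fun t => app C (u t - u' t)) p (timeMeasure b) := by
          have : (fun t => (κ : ℝ) * ‖app C (u t - u' t)‖) =
            (κ : ℝ) • fun t => ‖app C (u t - u' t)‖ := rfl
          rw [this, eLpNorm_const_smul, eLpNorm_norm, eLpNorm_norm,
            Real.enorm_of_nonneg κ.coe_nonneg, ENNReal.ofReal_coe_nnreal]
      _ ≤ Γ * ENNReal.ofReal δ ^ e * G + κ * (Γ * ENNReal.ofReal δ ^ e * G) := by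
          gcongr
          · exact hest hP hadmP
          · exact hest hC hadmC
      _ = (1 + κ) * Γ * ENNReal.ofReal δ ^ e * G := by ring
      _ ≤ _ := by gcongr

end Nonlinear
end MaxReg

theorem mainTheorem1 {𝕜 X : Type*} [RCLike 𝕜] [NormedAddCommGroup X] [NormedSpace 𝕜 X]
    [NormedSpace ℝ X] [IsScalarTower ℝ 𝕜 X] [CompleteSpace X]
    (p : ℝ≥0∞) (hp : 1 < p) (hp' : p ≠ ⊤)
    (A : X →ₗ.[𝕜] X) (hA_closed : A.IsClosed) (hA_dense : Dense (A.domain : Set X))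
    (τ₀ : ℝ) (hτ₀ : 0 < τ₀) (hA_reg : MaxReg.HasMaximalRegularity A p τ₀)
    (P C : A.domain →ₗ[𝕜] X)
    (hP : MaxReg.IsGraphBounded A P) (hC : MaxReg.IsGraphBounded A C)
    (hPC : MaxReg.IsAdmissible A p P C)
    (F : X → X) (κ : ℝ) (hκ : 0 < κ) (hF : ∀ x y : X, ‖F x - F y‖ ≤ κ * ‖x - y‖)
    (τ : ℝ) (hτ : 0 < τ) (x : X) (hx : x ∈ MaxReg.traceSpace A p) :
    ∃ u : ℝ → X,
      MaxReg.IsStrongSolution A p τ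
        (fun t => MaxReg.app P (u t) + F (MaxReg.app C (u t))) x u ∧
      (∀ w : ℝ → X,
        MaxReg.IsStrongSolution A p τ
          (fun t => MaxReg.app P (w t) + F (MaxReg.app C (w t))) x w →
        EqOn w u (Icc 0 τ)) ∧
      ∀ t ∈ Icc 0 τ,
        IntervalIntegrable (fun s => MaxReg.expNeg A (t - s) (MaxReg.app P (u s))) volume 0 t ∧
        IntervalIntegrable (fun s => MaxReg.expNeg A (t - s) (F (MaxReg.app C (u s))))
          volume 0 t ∧
        u t = MaxReg.expNeg A t x
          + (∫ s in (0 : ℝ)..t, MaxReg.expNeg A (t - s) (MaxReg.app P (u s)))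
          + ∫ s in (0 : ℝ)..t, MaxReg.expNeg A (t - s) (F (MaxReg.app C (u s))) := by
  obtain ⟨hS, hG⟩ := MaxReg.expNeg_spec hp.le hp' hτ₀ hA_closed hA_dense hA_reg
  obtain ⟨α, hα, γ, hγ, hadm⟩ := hPC
  have hγe : ∀ x : X, ENNReal.ofReal (γ * ‖x‖) = γ.toNNReal * ‖x‖ₑ := fun x => by
    rw [ENNReal.ofReal_mul hγ.le, ofReal_norm, ENNReal.ofReal]
  have hFκ : ∀ x y : X, ‖F x - F y‖ ≤ κ.toNNReal * ‖x - y‖ := fun x y => by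
    rw [Real.coe_toNNReal κ hκ.le]; exact hF x y
  obtain ⟨δ, hδ, hδτ₀, hδ1, hN⟩ := MaxReg.exists_contractsUpTo hp hp' hA_closed hA_dense hτ₀ hA_reg
    hS hG hP hC hα (fun x hx => le_self_add.trans ((hadm x hx).trans_eq (hγe x)))
    (fun x hx => le_add_self.trans ((hadm x hx).trans_eq (hγe x))) hFκ one_pos
  have hq : (1 / 2 : ℝ≥0) < 1 := by rw [← NNReal.coe_lt_coe]; norm_num
  obtain ⟨g₀, u₀, y₀, h₀⟩ := MaxReg.exists_sol_of_mem_traceSpace hp.le hx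
  obtain ⟨u, y, hu⟩ := hN.exists_sol_long hq hp.le hτ₀ hA_reg hδ hδτ₀ (h₀.mono hδ1) τ
  refine ⟨u, (MaxReg.isStrongSolution_iff hp.le hτ).2 ⟨y, hu⟩, fun w hw => ?_, fun t ht => ?_⟩
  · obtain ⟨z, hz⟩ := (MaxReg.isStrongSolution_iff hp.le hτ).1 hw
    exact hN.unique hq hp.le hτ₀ hA_reg hδ hδτ₀ hz hu
  · have iP := hS.intervalIntegrable_convolution
      (MaxReg.integrableOn_of_memLp hp.le (hu.memLp_app hP hp.le hτ.le)) ht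
    have iC := hS.intervalIntegrable_convolution
      (MaxReg.integrableOn_of_memLp hp.le
        (MaxReg.memLp_lipschitz_comp hF (hu.memLp_app hC hp.le hτ.le))) ht
    refine ⟨iP, iC, ?_⟩
    rw [hu.mild hp.le hS hG hτ ht, add_assoc, ← intervalIntegral.integral_add iP iC]
    simp only [map_add]
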